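/- **Conventions.** All signatures contain equality; interpretations have nonempty domains and assign values to the variables $x_0,x_1,x_2,\ldots$. A theory $T$ consists of the interpretations satisfying a given set of sentences $Ax(T)$. $T$ is *decidable* if the set of $T$-satisfiable quantifier-free formulas is decidable (formulas being coded by Gödel numbers). The *spectrum* $\mathrm{Spec}(T,\varphi)$ of a quantifier-free formula $\varphi$ is the set of countable (finite or $\aleph_0$) cardinalities of $T$-interpretations satisfying $\varphi$. $T$ is *gentle* if there is an algorithm that, for every conjunction $\varphi$ of literals, outputs a boolean $b$ and a finite set $S\subset\{1,2,3,\ldots\}$ such that $\mathrm{Spec}(T,\varphi)=S$ if $b$ is true, and $\mathrm{Spec}(T,\varphi)=(\{1,2,3,\ldots\}\cup\{\aleph_0\})\setminus S$ if $b$ is false. For theories $T_1,T_2$ over disjoint signatures $\Sigma_1,\Sigma_2$ (sharing only equality), $T_1\oplus T_2$ is the theory over $\Sigma_1\cup\Sigma_2$ axiomatized by $Ax(T_1)\cup Ax(T_2)$. **The theory $T_=$.** Its signature has only the $0$-ary predicate symbols $P_1,P_2,\ldots$ (besides equality), and its axioms are $P_n\to\psi_{=n}$ for $n\ge 1$, where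 $\psi_{=n}$ says that the domain has exactly $n$ elements. **The theory $T_f$.** Let $f:\{1,2,3,\ldots\}\to\{0,1\}$ be *admissible*: $f$ is not computable, $f(1)=1$, and for every $k\ge1$ the function $f$ takes each of the values $0$ and $1$ on exactly half of the numbers $1,\ldots,2^k$. For $i\in\{0,1\}$ let $f_i(k)$ be the number of $j\in\{1,\ldots,k\}$ with $f(j)=i$. The signature of $T_f$ has only a unary function symbol $s$ (besides equality), and its axioms are, for $k\ge1$, $$\bigl[\psi^{=}_{\ge f_1(k)}\wedge\psi^{\neq}_{\ge f_0(k)}\bigr]\ \vee\ \bigvee_{i=1}^{k}\bigl[\psi^{=}_{=f_1(i)}\wedge\psi^{\neq}_{=f_0(i)}\bigr],$$ where $\psi^{=}_{\ge n}$ and $\psi^{=}_{=n}$ say that at least, respectively exactly, $n$ elements satisfy $s(x)=x$, and $\psi^{\neq}_{\ge n}$, $\psi^{\neq}_{=n}$ say the same for $\neg(s(x)=x)$. **Theorem.** There are decidable theories $T_1$ and $T_2$ over disjoint signatures such that $T_1$ is gentle but $T_1\oplus T_2$ is undecidable. Explicitly: admissible functions $f$ exist, and for every admissible $f$ the theories $T_1=T_=$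 and $T_2=T_f$ are decidable, $T_=$ is gentle, and $T_=\oplus T_f$ is undecidable. -/

import Mathlib

namespace TheoryCombination

open FirstOrder FirstOrder.Language

/-! ### Gödel numbering of terms and formulas -/

section Coding

variable {L : FirstOrder.Language.{0, 0}} [∀ n, Encodable (L.Functions n)] [∀ n, Encodable (L.Relations n)]

/-- The Gödel number of a term. -/
def termCode {α : Type} [Encodable α] : L.Term α → ℕ
  | .var x => Nat.pair 0 (Encodable.encode x)
  | .func (l := l) f ts =>
      Nat.pair 1 (Nat.pair l (Nat.pair (Encodable.encode f)
        (Encodable.encode (List.ofFn fun i => termCode (ts i)))))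

/-- The Gödel number of a formula (Mathlib's primitive connectives are `⊥`, `=`, relation symbols,
implication and the universal quantifier; the others are abbreviations). -/
def formulaCode {α : Type} [Encodable α] : ∀ {n : ℕ}, L.BoundedFormula α n → ℕ
  | _, .falsum => Nat.pair 0 0
  | _, .equal t₁ t₂ => Nat.pair 1 (Nat.pair (termCode t₁) (termCode t₂))
  | _, .rel (l := l) R ts =>
      Nat.pair 2 (Nat.pair l (Nat.pair (Encodable.encode R)
        (Encodable.encode (List.ofFn fun i => termCode (ts i)))))
  | _, .imp φ ψ => Nat.pair 3 (Nat.pair (formulaCode φ) (formulaCode ψ))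
  | _, .all φ => Nat.pair 4 (formulaCode φ)

end Coding

/-! ### Satisfiability, decidability, spectra, gentleness

A theory is given by its axiomatization, a set of sentences. Formulas have their free variables
among `x₀, x₁, x₂, …`, indexed by `ℕ`. An interpretation is a nonempty structure together with a
valuation of the variables. -/

section Theories

variable {L : FirstOrder.Language.{0, 0}}

/-- `φ` is `T`-satisfiable. -/
def TSat (T : L.Theory) (φ : L.Formula ℕ) : Prop :=
  ∃ (M : Theory.ModelType.{0, 0, 0} T) (v : ℕ → M), φ.Realize v

/-- `T` is decidable: the set of (Gödel numbers of) `T`-satisfiable quantifier-free formulas is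
decidable. -/
def DecidableTheory [∀ n, Encodable (L.Functions n)] [∀ n, Encodable (L.Relations n)]
    (T : L.Theory) : Prop :=
  ComputablePred fun c : ℕ =>
    ∃ φ : L.Formula ℕ, BoundedFormula.IsQF φ ∧ TSat T φ ∧ formulaCode φ = c

/-- The spectrum of `T` with respect to `φ`: the set of countable cardinalities of
`T`-interpretations that satisfy `φ`. -/
def Spec (T : L.Theory) (φ : L.Formula ℕ) : Set Cardinal.{0} :=
  {κ | κ ≤ Cardinal.aleph0 ∧
    ∃ (M : Theory.ModelType.{0, 0, 0} T) (v : ℕ → M), φ.Realize v ∧ Cardinal.mk M = κ}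

/-- Literals: atomic formulas and their negations. -/
inductive IsLiteral : L.Formula ℕ → Prop
  | pos {φ : L.Formula ℕ} (h : BoundedFormula.IsAtomic φ) : IsLiteral φ
  | neg {φ : L.Formula ℕ} (h : BoundedFormula.IsAtomic φ) : IsLiteral (Formula.not φ)

/-- Cubes: finite conjunctions of literals, the empty conjunction included. -/
inductive IsCube : L.Formula ℕ → Prop
  | top : IsCube ⊤
  | lit {φ : L.Formula ℕ} (h : IsLiteral φ) : IsCube φ
  | and {φ ψ : L.Formula ℕ} (hφ : IsCube φ) (hψ : IsCube ψ) : IsCube (φ ⊓ ψ)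

/-- The set of cardinals given by a finite list of natural numbers. -/
def listCardinals (S : List ℕ) : Set Cardinal.{0} := {κ | ∃ n ∈ S, (n : Cardinal.{0}) = κ}

/-- `T` is gentle: an algorithm computes from every cube `φ` a boolean `b` and a finite set `S` of
positive integers (as a list) such that the spectrum of `φ` is `S` if `b` is true, and is the
complement of `S` in `{1, 2, 3, …} ∪ {ℵ₀}` if `b` is false. -/
def Gentle [∀ n, Encodable (L.Functions n)] [∀ n, Encodable (L.Relations n)]
    (T : L.Theory) : Prop :=
  ∃ g : ℕ → Bool × List ℕ, Computable g ∧
    ∀ φ : L.Formula ℕ, IsCube φ →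
      (∀ n ∈ (g (formulaCode φ)).2, 0 < n) ∧
      ((g (formulaCode φ)).1 = true → Spec T φ = listCardinals (g (formulaCode φ)).2) ∧
      ((g (formulaCode φ)).1 = false →
        Spec T φ = {κ | 1 ≤ κ ∧ κ ≤ Cardinal.aleph0} \ listCardinals (g (formulaCode φ)).2)

/-- The combination `T₁ ⊕ T₂`: the theory over the union of the two (disjoint) signatures that is
axiomatized by the union of the axiomatizations. `L₁.sum L₂` is the disjoint union, in which the
only symbol shared by the two copies is the built-in equality. -/
def combine {L₁ L₂ : FirstOrder.Language.{0, 0}} (T₁ : L₁.Theory) (T₂ : L₂.Theory) : (L₁.sum L₂).Theory :=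
  (LHom.sumInl : L₁ →ᴸ L₁.sum L₂).onTheory T₁ ∪ (LHom.sumInr : L₂ →ᴸ L₁.sum L₂).onTheory T₂

instance {L₁ L₂ : FirstOrder.Language.{0, 0}} [∀ n, Encodable (L₁.Functions n)]
    [∀ n, Encodable (L₂.Functions n)] (n : ℕ) : Encodable ((L₁.sum L₂).Functions n) :=
  inferInstanceAs (Encodable (L₁.Functions n ⊕ L₂.Functions n))

instance {L₁ L₂ : FirstOrder.Language.{0, 0}} [∀ n, Encodable (L₁.Relations n)]
    [∀ n, Encodable (L₂.Relations n)] (n : ℕ) : Encodable ((L₁.sum L₂).Relations n) :=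
  inferInstanceAs (Encodable (L₁.Relations n ⊕ L₂.Relations n))

end Theories

/-! ### The two signatures -/

/-- Predicate symbols `P₁, P₂, …`, all of arity `0`. -/
inductive PredSym : ℕ → Type
  | P (n : ℕ+) : PredSym 0

/-- One function symbol `s`, of arity `1`. -/
inductive FunSym : ℕ → Type
  | s : FunSym 1

/-- The signature whose only symbols are the `0`-ary predicates `P₁, P₂, …`. -/
def sigP : FirstOrder.Language.{0, 0} := ⟨fun _ => Empty, PredSym⟩

/-- The signature whose only symbol is the unary function symbol `s`. -/
def sigS : FirstOrder.Language.{0, 0} := ⟨FunSym, fun _ => Empty⟩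

/-- `Pₙ` as a relation symbol of `sigP`. -/
def symP (n : ℕ+) : sigP.Relations 0 := PredSym.P n

/-- `s` as a function symbol of `sigS`. -/
def symS : sigS.Functions 1 := FunSym.s

/-- The symbol `Pₙ` has code `n`. -/
instance (k : ℕ) : Encodable (PredSym k) where
  encode | .P n => (n : ℕ)
  decode c :=
    match k with
    | 0 => if h : 0 < c then some (.P ⟨c, h⟩) else none
    | _ + 1 => none
  encodek := by
    rintro ⟨n⟩
    simp only [PNat.pos, dif_pos]
    rfl

/-- The symbol `s` has code `0`. -/
instance (k : ℕ) : Encodable (FunSym k) where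
  encode _ := 0
  decode c :=
    match k with
    | 1 => if c = 0 then some .s else none
    | _ => none
  encodek := by
    rintro ⟨⟩
    simp

instance (n : ℕ) : Encodable (sigP.Functions n) := inferInstanceAs (Encodable Empty)
instance (n : ℕ) : Encodable (sigP.Relations n) := inferInstanceAs (Encodable (PredSym n))
instance (n : ℕ) : Encodable (sigS.Functions n) := inferInstanceAs (Encodable (FunSym n))
instance (n : ℕ) : Encodable (sigS.Relations n) := inferInstanceAs (Encodable Empty)

/-! ### The theory `T₌`, axiomatized by the sentences `Pₙ → ψ₌ₙ` for `n ≥ 1` -/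

/-- `ψ_{≤ n}`: `∃ x₁ … xₙ, ∀ y, y = x₁ ∨ … ∨ y = xₙ`. -/
noncomputable def psiLe (L : FirstOrder.Language.{0, 0}) (n : ℕ) : L.Sentence :=
  (BoundedFormula.iSup fun i : Fin n =>
    ((&(Fin.last n) : L.Term (Empty ⊕ Fin (n + 1))) =' &(Fin.castSucc i))).all.exs

/-- `ψ_{= n}`: there are exactly `n` elements (`Sentence.cardGe L n` is `ψ_{≥ n}`). -/
noncomputable def psiEq (L : FirstOrder.Language.{0, 0}) (n : ℕ) : L.Sentence :=
  Sentence.cardGe L n ⊓ psiLe L n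

/-- The atomic sentence `Pₙ`. -/
def predAtom (n : ℕ+) : sigP.Sentence :=
  (symP n).formula Fin.elim0

/-- The theory `T₌`. -/
noncomputable def Teq : sigP.Theory :=
  Set.range fun n : ℕ+ => Formula.imp (predAtom n) (psiEq sigP n)

/-! ### The theory `T_f` -/

/-- `s(t) = t`. -/
def fixF {n : ℕ} (t : sigS.Term (Empty ⊕ Fin n)) : sigS.BoundedFormula Empty n :=
  symS.apply₁ t =' t

/-- `¬ s(t) = t`. -/
def nonfixF {n : ℕ} (t : sigS.Term (Empty ⊕ Fin n)) : sigS.BoundedFormula Empty n :=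
  (fixF t).not

/-- `x₁, …, xₙ` are pairwise distinct. -/
noncomputable def distinctF (n : ℕ) : sigS.BoundedFormula Empty n :=
  BoundedFormula.iInf fun p : {p : Fin n × Fin n // p.1 < p.2} =>
    ((&p.1.1 : sigS.Term (Empty ⊕ Fin n)) =' &p.1.2).not

/-- At least `n` elements satisfy `q`. -/
noncomputable def atLeastF (q : ∀ {m : ℕ}, sigS.Term (Empty ⊕ Fin m) → sigS.BoundedFormula Empty m)
    (n : ℕ) : sigS.Sentence :=
  (distinctF n ⊓ BoundedFormula.iInf fun i : Fin n => q (&i)).exs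

/-- Exactly `n` elements satisfy `q`. -/
noncomputable def exactlyF (q : ∀ {m : ℕ}, sigS.Term (Empty ⊕ Fin m) → sigS.BoundedFormula Empty m)
    (n : ℕ) : sigS.Sentence :=
  (distinctF n ⊓ (BoundedFormula.iInf fun i : Fin n => q (&i)) ⊓
    ((q (&(Fin.last n))).imp (BoundedFormula.iSup fun i : Fin n =>
      ((&(Fin.last n) : sigS.Term (Empty ⊕ Fin (n + 1))) =' &(Fin.castSucc i)))).all).exs

/-- `f_i(k)`: the number of `j ∈ {1, …, k}` with `f(j) = i`. -/
def countVal (f : ℕ+ → Fin 2) (i : Fin 2) (k : ℕ+) : ℕ :=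
  ((Finset.Icc 1 k).filter fun j => f j = i).card

/-- The functions `f` from which `T_f` is built: `f` is not computable, `f(1) = 1`, and for every
`k ≥ 1`, `f` takes the values `0` and `1` equally often on `{1, …, 2ᵏ}`. -/
structure Admissible (f : ℕ+ → Fin 2) : Prop where
  not_computable : ¬ Computable fun n : ℕ => f n.succPNat
  map_one : f 1 = 1
  balanced : ∀ k : ℕ, 1 ≤ k → countVal f 0 (2 ^ k) = countVal f 1 (2 ^ k)

/-- The theory `T_f`, with one axiom for each `k ≥ 1`. -/
noncomputable def Tf (f : ℕ+ → Fin 2) : sigS.Theory :=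
  Set.range fun k : ℕ+ =>
    (atLeastF fixF (countVal f 1 k) ⊓ atLeastF nonfixF (countVal f 0 k)) ⊔
      Formula.iSup fun i : Finset.Icc (1 : ℕ+) k =>
        (exactlyF fixF (countVal f 1 i) ⊓ exactlyF nonfixF (countVal f 0 i) : sigS.Sentence)

end TheoryCombination

/-!
A quantifier-free formula `φ` can mention only finitely many terms and predicates, and its truth
depends only on the equalities between the terms. Hence `φ` is satisfiable in `T₌` or `T_f` as soon
as it is true in a structure whose size is bounded by its Gödel number. For `T_f` any finite
structure extends to a model with infinitely many fixed points and infinitely many other points,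
whatever `f` is. For `T₌` all sufficiently large cardinalities behave alike, because a model of one
of them satisfies no `Pₙ` that is mentioned in `φ`.

In a model of `T₌ ⊕ T_f` that satisfies `Pₙ`, there are exactly `n` elements, and `f₁(n)` of them
are fixed by `s`. So for `m ≥ 1` a formula saying that `Pₙ` holds and `x₀, …, xₘ₋₁` are pairwise
distinct fixed points is satisfiable if and only if `m ≤ f₁(n)`. A decision procedure for
`T₌ ⊕ T_f` would therefore compute `f₁`, and with it `f`.
-/

namespace TheoryCombination

open FirstOrder FirstOrder.Language

/-! ### Primitive recursive and computable predicates -/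

theorem primrec₂_pow : Primrec₂ fun a b : ℕ => a ^ b := by
  have h : Primrec₂ fun a b : ℕ => (Nat.rec 1 (fun _ x => x * a) b : ℕ) :=
    Primrec.nat_rec (f := fun _ : ℕ => 1) (g := fun a p => p.2 * a) (Primrec.const 1)
      (Primrec.nat_mul.comp (Primrec.snd.comp Primrec.snd) Primrec.fst)
  refine h.of_eq fun a b => ?_
  induction b with
  | zero => rfl
  | succ b ih => rw [pow_succ, ← ih]

theorem primrecPred_exists_lt {α : Type*} [Primcodable α] {R : α → ℕ → Prop} (hR : PrimrecRel R)
    {b : α → ℕ} (hb : Primrec b) : PrimrecPred fun a => ∃ x < b a, R a x :=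
  (PrimrecRel.exists_mem_list (R := fun x a => R a x) (hR.comp Primrec.snd Primrec.fst)
    |>.comp (Primrec.list_range.comp hb) Primrec.id).of_eq (by simp)

/-- The digit of `a` at position `i` in base `b`, the least significant digit having position `0`.
Sequences of bounded length with bounded entries are searched through their base-`b` values. -/
def digit (b a i : ℕ) : ℕ := a / b ^ i % b

theorem primrec_digit : Primrec fun p : ℕ × ℕ × ℕ => digit p.1 p.2.1 p.2.2 :=
  Primrec.nat_mod.comp (Primrec.nat_div.comp (Primrec.fst.comp Primrec.snd)
    (primrec₂_pow.comp Primrec.fst (Primrec.snd.comp Primrec.snd))) Primrec.fst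

theorem digit_lt {b : ℕ} (hb : 0 < b) (a i : ℕ) : digit b a i < b := Nat.mod_lt _ hb

theorem exists_digit_eq {b n : ℕ} (g : Fin n → Fin b) :
    ∃ a < b ^ n, ∀ i : Fin n, digit b a i = g i := by
  refine ⟨finFunctionFinEquiv g, Fin.is_lt _, fun i => ?_⟩
  exact congrArg Fin.val (congrFun (finFunctionFinEquiv.symm_apply_apply g) i)

theorem computable_of_computablePred_lt {c : ℕ → ℕ}
    (h : ComputablePred fun p : ℕ × ℕ => p.2 < c p.1) : Computable c := by
  obtain ⟨b, hb, hbc⟩ := ComputablePred.computable_iff.1 h.not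
  have hb_iff (n m : ℕ) : b (n, m) = true ↔ c n ≤ m := by
    rw [← not_lt]
    exact (congrFun hbc (n, m)).symm.to_iff
  have hfind : Partrec fun n => Nat.rfind fun m => (b (n, m) : Part Bool) :=
    Partrec.rfind hb.partrec
  refine hfind.of_eq_tot fun n => Nat.mem_rfind.2 ⟨?_, fun {m} hm => ?_⟩
  · exact Part.mem_some_iff.2 ((hb_iff n _).2 le_rfl).symm
  · exact Part.mem_some_iff.2 (Bool.eq_false_iff.2 fun h => ((hb_iff n m).1 h).not_gt hm).symm

theorem computablePred_of_computable_count {p : ℕ → Prop} [DecidablePred p]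
    (h : Computable (Nat.count p)) : ComputablePred p := by
  refine ComputablePred.computable_iff.2 ⟨fun n => decide (Nat.count p n < Nat.count p (n + 1)),
    Primrec.nat_lt.decide.to_comp.comp h (h.comp Computable.succ), ?_⟩
  simp only [Nat.count_lt_count_succ_iff, decide_eq_true_eq]

theorem computable_of_computablePred_eq_one {g : ℕ → Fin 2}
    (h : ComputablePred fun n => g n = 1) : Computable g := by
  obtain ⟨_, hg⟩ := h
  refine (Computable.cond hg (Computable.const 1) (Computable.const 0)).of_eq fun n => ?_
  by_cases hn : g n = 1
  · simp [hn]
  · simp only [hn, decide_false, cond_false]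
    omega

/-! ### Gödel numbers -/

theorem pair_pos {k : ℕ} (m : ℕ) (hk : 0 < k) : 0 < Nat.pair k m :=
  hk.trans_le (Nat.left_le_pair k m)

theorem right_lt_pair {k : ℕ} (m : ℕ) (hk : 0 < k) : m < Nat.pair k m := by
  have := Nat.add_le_pair k m
  omega

theorem lt_of_unpair_fst {c k : ℕ} (h : c.unpair.1 = k + 1) :
    c.unpair.2.unpair.1 < c ∧ c.unpair.2.unpair.2 < c := by
  have h1 := Nat.unpair_add_le c
  have h2 := Nat.unpair_left_le c.unpair.2
  have h3 := Nat.unpair_right_le c.unpair.2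
  omega

section Codes

variable {L : FirstOrder.Language.{0, 0}} [∀ n, Encodable (L.Functions n)] {β : Type} [Encodable β]

theorem termCode_injective :
    Function.Injective (termCode : L.Term β → ℕ) := by
  intro t
  induction t with
  | var x =>
    intro t' h
    cases t' with
    | var y =>
      simp only [termCode, Nat.pair_eq_pair, Encodable.encode_inj, true_and] at h
      rw [h]
    | func => simp [termCode] at h
  | @func l F ts ih =>
    intro t' h
    cases t' with
    | var => simp [termCode] at h
    | @func l' F' ts' =>
      simp only [termCode, Nat.pair_eq_pair, true_and] at h
      obtain ⟨rfl, hF, hts⟩ := h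
      obtain rfl := Encodable.encode_injective hF
      have hts' := List.ofFn_injective (Encodable.encode_injective hts)
      congr 1
      exact funext fun i => ih i (congrFun hts' i)

/-- The number of a variable `xᵢ` as a function of its code; `none` on all other numbers. -/
def varDecode (c : ℕ) : Option ℕ :=
  if c.unpair.1 = 0 ∧ c.unpair.2 % 2 = 0 then some (c.unpair.2 / 2) else none

theorem primrec_varDecode : Primrec varDecode :=
  Primrec.ite
    (PrimrecPred.and
      (Primrec.eq.comp (Primrec.fst.comp Primrec.unpair) (Primrec.const 0))
      (Primrec.eq.comp (Primrec.nat_mod.comp (Primrec.snd.comp Primrec.unpair) (Primrec.const 2))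
        (Primrec.const 0)))
    (Primrec.option_some.comp
      (Primrec.nat_div.comp (Primrec.snd.comp Primrec.unpair) (Primrec.const 2)))
    (Primrec.const none)

theorem varDecode_termCode (i : ℕ) :
    varDecode (termCode (Term.var (Sum.inl i) : L.Term (ℕ ⊕ Fin 0))) = some i := by
  simp [varDecode, termCode]

theorem termCode_of_varDecode {c i : ℕ} (h : varDecode c = some i) :
    termCode (Term.var (Sum.inl i) : L.Term (ℕ ⊕ Fin 0)) = c := by
  simp only [varDecode, Option.ite_none_right_eq_some, Option.some.injEq] at h
  obtain ⟨⟨h1, h2⟩, rfl⟩ := h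
  have : 2 * (c.unpair.2 / 2) = c.unpair.2 := by omega
  simp only [termCode, Encodable.encode_inl, Encodable.encode_nat, this]
  rw [← h1, Nat.pair_unpair]

theorem le_termCode_var (i : ℕ) :
    i ≤ termCode (Term.var (Sum.inl i) : L.Term (ℕ ⊕ Fin 0)) := by
  simp only [termCode, Encodable.encode_inl, Encodable.encode_nat]
  have := Nat.right_le_pair 0 (2 * i)
  omega

variable [∀ n, Encodable (L.Relations n)]

/-- The code of the atom `R(t₁, …, tₗ)` without its leading tag. -/
def relCode {l : ℕ} (R : L.Relations l) (ts : Fin l → L.Term β) : ℕ :=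
  Nat.pair l (Nat.pair (Encodable.encode R) (Encodable.encode (List.ofFn fun i => termCode (ts i))))

theorem formulaCode_injective {n : ℕ} :
    Function.Injective (formulaCode : L.BoundedFormula β n → ℕ) := by
  intro φ
  induction φ with
  | falsum =>
    intro ψ h
    cases ψ <;> simp [formulaCode] at h
    rfl
  | equal t₁ t₂ =>
    intro ψ h
    cases ψ <;> simp only [formulaCode, Nat.pair_eq_pair, true_and] at h
    case equal => rw [termCode_injective h.1, termCode_injective h.2]
    all_goals exact absurd h.1 (by decide)
  | @rel n l R ts =>
    intro ψ h
    cases ψ <;> simp only [formulaCode, Nat.pair_eq_pair, true_and] at h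
    case rel =>
      obtain ⟨rfl, hR, hts⟩ := h
      obtain rfl := Encodable.encode_injective hR
      have hts' := List.ofFn_injective (Encodable.encode_injective hts)
      congr 1
      exact funext fun i => termCode_injective (congrFun hts' i)
    all_goals exact absurd h.1 (by decide)
  | imp φ₁ φ₂ ih₁ ih₂ =>
    intro ψ h
    cases ψ <;> simp only [formulaCode, Nat.pair_eq_pair, true_and] at h
    case imp => rw [ih₁ h.1, ih₂ h.2]
    all_goals exact absurd h.1 (by decide)
  | all φ ih =>
    intro ψ h
    cases ψ <;> simp only [formulaCode, Nat.pair_eq_pair, true_and] at h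
    case all => rw [ih h]
    all_goals exact absurd h.1 (by decide)

end Codes

/-! ### Evaluating quantifier-free formulas on their Gödel numbers -/

section Evaluation

variable {α : Type*}

/-- Evaluation of an atomic formula on its Gödel number `c`. The function `tv` evaluates codes of
terms, `rv` evaluates codes of relational atoms in the sense of `relCode`, and `a` is a parameter of
both. The value is `none` on numbers that are not codes. -/
def atomEval (tv : α → ℕ → Option ℕ) (rv : α → ℕ → Option Bool) (a : α) (c : ℕ) : Option Bool :=
  if c = 0 then some false
  else if c.unpair.1 = 1 then
    (tv a c.unpair.2.unpair.1).bind fun x => (tv a c.unpair.2.unpair.2).map fun y => decide (x = y)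
  else if c.unpair.1 = 2 then rv a c.unpair.2
  else none

/-- Evaluation of a quantifier-free formula on its Gödel number, extending `atomEval` to
implications. -/
def qfEval (tv : α → ℕ → Option ℕ) (rv : α → ℕ → Option Bool) (a : α) (c : ℕ) : Option Bool :=
  if _h : c.unpair.1 = 3 then
    (qfEval tv rv a c.unpair.2.unpair.1).bind fun x =>
      (qfEval tv rv a c.unpair.2.unpair.2).map fun y => !x || y
  else atomEval tv rv a c
termination_by c
decreasing_by
  · exact (lt_of_unpair_fst _h).1
  · exact (lt_of_unpair_fst _h).2

variable (tv : α → ℕ → Option ℕ) (rv : α → ℕ → Option Bool) (a : α)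

theorem qfEval_zero : qfEval tv rv a 0 = some false := by
  rw [qfEval]
  simp [atomEval]

theorem qfEval_pair_one (m n : ℕ) :
    qfEval tv rv a (Nat.pair 1 (Nat.pair m n)) =
      (tv a m).bind fun x => (tv a n).map fun y => decide (x = y) := by
  rw [qfEval]
  simp [atomEval, (pair_pos _ Nat.one_pos).ne']

theorem qfEval_pair_two (m : ℕ) : qfEval tv rv a (Nat.pair 2 m) = rv a m := by
  rw [qfEval]
  simp [atomEval, (pair_pos _ Nat.two_pos).ne']

theorem qfEval_pair_three (m n : ℕ) :
    qfEval tv rv a (Nat.pair 3 (Nat.pair m n)) =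
      (qfEval tv rv a m).bind fun x => (qfEval tv rv a n).map fun y => !x || y := by
  rw [qfEval]
  simp

variable {tv rv} [Primcodable α]

theorem primrec_atomEval (ht : Primrec₂ tv) (hr : Primrec₂ rv) : Primrec₂ (atomEval tv rv) := by
  have hc : Primrec fun p : α × ℕ => p.2.unpair := Primrec.unpair.comp Primrec.snd
  have hc2 : Primrec fun p : α × ℕ => p.2.unpair.2.unpair :=
    Primrec.unpair.comp (Primrec.snd.comp hc)
  refine Primrec.ite (Primrec.eq.comp Primrec.snd (Primrec.const 0)) (Primrec.const _) ?_
  refine Primrec.ite (Primrec.eq.comp (Primrec.fst.comp hc) (Primrec.const 1)) ?_ ?_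
  · refine Primrec.option_bind (ht.comp Primrec.fst (Primrec.fst.comp hc2)) ?_
    refine Primrec.option_map (ht.comp (Primrec.fst.comp Primrec.fst)
      (Primrec.snd.comp (hc2.comp Primrec.fst))) ?_
    exact Primrec.eq.decide.comp (Primrec.snd.comp Primrec.fst) Primrec.snd
  · exact Primrec.ite (Primrec.eq.comp (Primrec.fst.comp hc) (Primrec.const 2))
      (hr.comp Primrec.fst (Primrec.snd.comp hc)) (Primrec.const _)

theorem primrec_qfEval (ht : Primrec₂ tv) (hr : Primrec₂ rv) : Primrec₂ (qfEval tv rv) := by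
  let g : α → List (Option Bool) → Option (Option Bool) := fun a l =>
    some (if l.length.unpair.1 = 3 then
      (l.getD l.length.unpair.2.unpair.1 none).bind fun x =>
        (l.getD l.length.unpair.2.unpair.2 none).map fun y => !x || y
    else atomEval tv rv a l.length)
  refine Primrec.nat_strong_rec (g := g) (qfEval tv rv) ?_ ?_
  · have hc : Primrec fun p : α × List (Option Bool) => p.2.length.unpair :=
      Primrec.unpair.comp (Primrec.list_length.comp Primrec.snd)
    have hc2 : Primrec fun p : α × List (Option Bool) => p.2.length.unpair.2.unpair :=
      Primrec.unpair.comp (Primrec.snd.comp hc)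
    refine Primrec.option_some.comp (Primrec.ite
      (Primrec.eq.comp (Primrec.fst.comp hc) (Primrec.const 3)) ?_ ?_)
    · refine Primrec.option_bind
        ((Primrec.list_getD none).comp Primrec.snd (Primrec.fst.comp hc2)) ?_
      refine Primrec.option_map ((Primrec.list_getD none).comp (Primrec.snd.comp Primrec.fst)
        (Primrec.snd.comp (hc2.comp Primrec.fst))) ?_
      exact Primrec.or.comp (Primrec.not.comp (Primrec.snd.comp Primrec.fst)) Primrec.snd
    · exact (primrec_atomEval ht hr).comp Primrec.fst (Primrec.list_length.comp Primrec.snd)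
  · intro a n
    rw [qfEval]
    by_cases h : n.unpair.1 = 3
    · have := lt_of_unpair_fst h
      simp [g, h, List.getD, this.1, this.2]
    · simp [g, h]

end Evaluation

section Correctness

variable {L : FirstOrder.Language.{0, 0}} [∀ n, Encodable (L.Functions n)]

/-- The values, under the valuation `w`, of all terms with code less than `N`. Only finitely many
elements of `M` matter for the truth value of a formula with code at most `N`. -/
def termValues {M : Type*} [L.Structure M] (w : ℕ → M) (N : ℕ) : Set M :=
  (fun t : L.Term (ℕ ⊕ Fin 0) => t.realize (Sum.elim w default)) '' {t | termCode t < N}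

theorem encard_termValues_le {M : Type*} [L.Structure M] (w : ℕ → M) (N : ℕ) :
    (termValues (L := L) w N).encard ≤ N := by
  calc (termValues (L := L) w N).encard
      ≤ {t : L.Term (ℕ ⊕ Fin 0) | termCode t < N}.encard := Set.encard_image_le _ _
    _ ≤ (Set.Iio N).encard :=
        Set.encard_le_encard_of_injOn (fun _ ht => ht) termCode_injective.injOn
    _ = N := by rw [← Finset.coe_Iio, Set.encard_coe_eq_coe_finsetCard, Nat.card_Iio]

theorem exists_injOn_termValues {M : Type*} [L.Structure M] (w : ℕ → M) {N n : ℕ} [NeZero n]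
    (h : N ≤ n) : ∃ e : M → Fin n, Set.InjOn e (termValues (L := L) w N) := by
  have hN := encard_termValues_le (L := L) w N
  obtain ⟨e, -, he⟩ := (Set.finite_of_encard_le_coe hN).exists_injOn_of_encard_le
    (t := (Set.univ : Set (Fin n))) (hN.trans (by simpa using h))
  exact ⟨e, he⟩

variable [∀ n, Encodable (L.Relations n)] {α : Type*} {tv : α → ℕ → Option ℕ}
  {rv : α → ℕ → Option Bool}

open Classical in
theorem qfEval_formulaCode {M : Type*} [L.Structure M] {w : ℕ → M} {a : α} {N : ℕ} {e : M → ℕ}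
    (he : Set.InjOn e (termValues (L := L) w N))
    (ht : ∀ t : L.Term (ℕ ⊕ Fin 0), termCode t < N →
      tv a (termCode t) = some (e (t.realize (Sum.elim w default))))
    (hr : ∀ {l : ℕ} (R : L.Relations l) (ts : Fin l → L.Term (ℕ ⊕ Fin 0)), relCode R ts < N →
      rv a (relCode R ts) =
        some (decide (Structure.RelMap R fun i => (ts i).realize (Sum.elim w default))))
    {φ : L.Formula ℕ} (hφ : BoundedFormula.IsQF φ) (hc : formulaCode φ ≤ N) :
    qfEval tv rv a (formulaCode φ) = some (decide (φ.Realize w)) := by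
  induction hφ with
  | falsum =>
    refine (qfEval_zero tv rv a).trans (congrArg some ?_)
    exact (decide_eq_false (p := Formula.Realize (.falsum : L.Formula ℕ) w) id).symm
  | of_isAtomic h =>
    rcases h with ⟨t, t'⟩ | ⟨R, ts⟩
    · have hlt : Nat.pair (termCode t) (termCode t') < N :=
        (right_lt_pair _ Nat.one_pos).trans_le hc
      have hlt₁ := (Nat.left_le_pair _ _).trans_lt hlt
      have hlt₂ := (Nat.right_le_pair _ _).trans_lt hlt
      have hinj := he.eq_iff (Set.mem_image_of_mem _ hlt₁) (Set.mem_image_of_mem _ hlt₂)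
      refine (qfEval_pair_one tv rv a _ _).trans ?_
      simp only [ht t hlt₁, ht t' hlt₂, Option.bind_some, Option.map_some, hinj]
      rfl
    · exact (qfEval_pair_two tv rv a _).trans (hr R ts ((right_lt_pair _ Nat.two_pos).trans_le hc))
  | @imp φ₁ φ₂ _ _ ih₁ ih₂ =>
    have hlt : Nat.pair (formulaCode φ₁) (formulaCode φ₂) ≤ N :=
      (right_lt_pair _ three_pos).le.trans hc
    refine (qfEval_pair_three tv rv a _ _).trans ?_
    rw [ih₁ ((Nat.left_le_pair _ _).trans hlt), ih₂ ((Nat.right_le_pair _ _).trans hlt)]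
    refine congrArg some (Bool.eq_iff_iff.2 ?_)
    rw [Bool.or_eq_true, Bool.not_eq_true', decide_eq_false_iff_not, decide_eq_true_iff,
      decide_eq_true_iff, ← imp_iff_not_or]
    rfl

theorem exists_formulaCode_of_atomEval {a : α} {c : ℕ} {b : Bool}
    (ht : ∀ c x, tv a c = some x → ∃ t : L.Term (ℕ ⊕ Fin 0), termCode t = c)
    (hr : ∀ c b, rv a c = some b →
      ∃ (l : ℕ) (R : L.Relations l) (ts : Fin l → L.Term (ℕ ⊕ Fin 0)), relCode R ts = c)
    (hc : atomEval tv rv a c = some b) :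
    ∃ φ : L.Formula ℕ, BoundedFormula.IsQF φ ∧ formulaCode φ = c := by
  have hpair : Nat.pair c.unpair.1 c.unpair.2 = c := Nat.pair_unpair c
  simp only [atomEval] at hc
  split_ifs at hc with h0 h1 h2
  · exact ⟨⊥, BoundedFormula.isQF_bot, by rw [h0]; rfl⟩
  · simp only [Option.bind_eq_some_iff, Option.map_eq_some_iff] at hc
    obtain ⟨x, hx, y, hy, -⟩ := hc
    obtain ⟨t, ht₁⟩ := ht _ _ hx
    obtain ⟨t', ht₂⟩ := ht _ _ hy
    refine ⟨t.bdEqual t', (BoundedFormula.IsAtomic.equal t t').isQF, ?_⟩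
    rw [Term.bdEqual, formulaCode, ht₁, ht₂, Nat.pair_unpair, ← h1, hpair]
  · obtain ⟨l, R, ts, hR⟩ := hr _ _ hc
    refine ⟨R.boundedFormula ts, (BoundedFormula.IsAtomic.rel R ts).isQF, ?_⟩
    rw [relCode] at hR
    rw [Relations.boundedFormula, formulaCode, hR, ← h2, hpair]

theorem exists_formulaCode_of_qfEval {a : α}
    (ht : ∀ c x, tv a c = some x → ∃ t : L.Term (ℕ ⊕ Fin 0), termCode t = c)
    (hr : ∀ c b, rv a c = some b →
      ∃ (l : ℕ) (R : L.Relations l) (ts : Fin l → L.Term (ℕ ⊕ Fin 0)), relCode R ts = c)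
    {c : ℕ} {b : Bool} (hc : qfEval tv rv a c = some b) :
    ∃ φ : L.Formula ℕ, BoundedFormula.IsQF φ ∧ formulaCode φ = c := by
  induction c using Nat.strong_induction_on generalizing b with
  | _ c ih =>
    rw [qfEval] at hc
    split_ifs at hc with h
    · simp only [Option.bind_eq_some_iff, Option.map_eq_some_iff] at hc
      obtain ⟨x, hx, y, hy, -⟩ := hc
      obtain ⟨φ, hφ, hφc⟩ := ih _ (lt_of_unpair_fst h).1 hx
      obtain ⟨ψ, hψ, hψc⟩ := ih _ (lt_of_unpair_fst h).2 hy
      refine ⟨φ.imp ψ, hφ.imp hψ, ?_⟩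
      rw [formulaCode, hφc, hψc, Nat.pair_unpair, ← h, Nat.pair_unpair]
    · exact exists_formulaCode_of_atomEval ht hr hc

end Correctness

/-! ### Spectra -/

open Classical in
/-- The positive `n ≤ c` for which `Sat n c` differs from the value that `Sat` takes at all numbers
greater than `c`. -/
noncomputable def exceptions (Sat : ℕ → ℕ → Prop) (c : ℕ) : List ℕ :=
  ((List.range c).map Nat.succ).filter fun n => ¬ (Sat n c ↔ Sat (c + 1) c)

theorem mem_exceptions {Sat : ℕ → ℕ → Prop} {n c : ℕ} :
    n ∈ exceptions Sat c ↔ 0 < n ∧ n ≤ c ∧ ¬ (Sat n c ↔ Sat (c + 1) c) := by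
  rcases n with _ | n <;> simp [exceptions]

theorem primrec_exceptions {Sat : ℕ → ℕ → Prop} (hSat : PrimrecRel Sat) :
    Primrec (exceptions Sat) := by
  classical
  have hiff : PrimrecRel fun n c => ¬ (Sat n c ↔ Sat (c + 1) c) := by
    refine (PrimrecPred.not (Primrec.eq.comp hSat.decide
      ((hSat.comp Primrec.succ Primrec.id).decide.comp Primrec.snd))).of_eq fun p => ?_
    exact not_congr decide_eq_decide
  refine (hiff.listFilter.comp (Primrec.list_map Primrec.list_range
    (Primrec.succ.comp Primrec.snd).to₂) Primrec.id).of_eq fun c => ?_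
  simp only [exceptions, id]

section Spectra

variable {L : FirstOrder.Language.{0, 0}}

theorem IsCube.isQF {φ : L.Formula ℕ} (h : IsCube φ) : BoundedFormula.IsQF φ := by
  induction h with
  | top => exact BoundedFormula.IsQF.top
  | lit h =>
    rcases h with h | h
    · exact h.isQF
    · exact h.isQF.not
  | and _ _ h₁ h₂ => exact h₁.inf h₂

variable {T : L.Theory} {φ : L.Formula ℕ}

theorem one_le_of_mem_Spec {κ : Cardinal.{0}} (h : κ ∈ Spec T φ) : 1 ≤ κ := by
  obtain ⟨-, M, v, -, rfl⟩ := h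
  exact Cardinal.one_le_iff_ne_zero.2 (Cardinal.mk_ne_zero_iff.2 ⟨v 0⟩)

theorem tSat_iff_Spec_nonempty [Countable L.Symbols] : TSat T φ ↔ (Spec T φ).Nonempty := by
  refine ⟨fun ⟨M, v, hv⟩ => ?_, fun ⟨_, _, M, v, hv, _⟩ => ⟨M, v, hv⟩⟩
  rcases finite_or_infinite M with hM | hM
  · exact ⟨_, Cardinal.mk_le_aleph0, M, v, hv, rfl⟩
  obtain ⟨S, hvS, hS⟩ := exists_elementarySubstructure_card_eq L (Set.range v) Cardinal.aleph0
    le_rfl (by simpa using (Set.countable_range v).le_aleph0)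
    (Cardinal.lift_le.2 (Cardinal.mk_le_aleph0 (α := L.Symbols))) (by simp)
  let w (i : ℕ) : S := ⟨v i, hvS ⟨i, rfl⟩⟩
  have hw : φ.Realize w := (S.subtype.map_formula φ w).1 hv
  exact ⟨Cardinal.aleph0, le_rfl, Theory.ModelType.of T S, w, hw, by simpa using hS⟩

variable [∀ n, Encodable (L.Functions n)] [∀ n, Encodable (L.Relations n)]

/-- `Sat n c` is a primitive recursive criterion for the quantifier-free formula with code `c` to
have a `T`-interpretation with `n` elements, and for `n > c` also for it to have one with `ℵ₀`
elements. In particular `Sat n c` does not depend on `n` once `n > c`. -/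
structure DecidesSpectra (T : L.Theory) (Sat : ℕ → ℕ → Prop) : Prop where
  primrecRel : PrimrecRel Sat
  exists_formulaCode {n c : ℕ} :
    Sat n c → ∃ φ : L.Formula ℕ, BoundedFormula.IsQF φ ∧ formulaCode φ = c
  natCast_mem_Spec {φ : L.Formula ℕ} {n : ℕ} : BoundedFormula.IsQF φ → 0 < n →
    ((n : Cardinal.{0}) ∈ Spec T φ ↔ Sat n (formulaCode φ))
  aleph0_mem_Spec {φ : L.Formula ℕ} {n : ℕ} : BoundedFormula.IsQF φ → formulaCode φ < n →
    (Cardinal.aleph0 ∈ Spec T φ ↔ Sat n (formulaCode φ))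

namespace DecidesSpectra

variable {Sat : ℕ → ℕ → Prop} (h : DecidesSpectra T Sat)
include h

theorem natCast_mem_Spec_iff_aleph0_mem_Spec {n : ℕ} (hφ : BoundedFormula.IsQF φ)
    (hn : formulaCode φ < n) : (n : Cardinal.{0}) ∈ Spec T φ ↔ Cardinal.aleph0 ∈ Spec T φ :=
  (h.natCast_mem_Spec hφ (Nat.zero_lt_of_lt hn)).trans (h.aleph0_mem_Spec hφ hn).symm

theorem tSat_iff_exists_lt (hφ : BoundedFormula.IsQF φ) :
    TSat T φ ↔ ∃ n < formulaCode φ + 1, Sat (n + 1) (formulaCode φ) := by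
  simp only [tSat_iff_Spec_nonempty, ← h.natCast_mem_Spec hφ (Nat.succ_pos _)]
  refine ⟨fun ⟨κ, hκ⟩ => ?_, fun ⟨_, _, hn⟩ => ⟨_, hn⟩⟩
  have of_aleph0 (h₀ : Cardinal.aleph0 ∈ Spec T φ) :
      ∃ n < formulaCode φ + 1, ((n + 1 : ℕ) : Cardinal.{0}) ∈ Spec T φ :=
    ⟨formulaCode φ, Nat.lt_succ_self _,
      (h.natCast_mem_Spec_iff_aleph0_mem_Spec hφ (Nat.lt_succ_self _)).2 h₀⟩
  rcases hκ.1.lt_or_eq with hlt | rfl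
  · obtain ⟨n, rfl⟩ := Cardinal.lt_aleph0.1 hlt
    rcases le_or_gt n (formulaCode φ) with hn | hn
    · have : 1 ≤ n := by exact_mod_cast one_le_of_mem_Spec hκ
      exact ⟨n - 1, by omega, by rwa [Nat.succ_eq_add_one, Nat.sub_add_cancel this]⟩
    · exact of_aleph0 ((h.natCast_mem_Spec_iff_aleph0_mem_Spec hφ hn).1 hκ)
  · exact of_aleph0 hκ

theorem decidableTheory : DecidableTheory T := by
  have hsearch : PrimrecPred fun c => ∃ n < c + 1, Sat (n + 1) c :=
    primrecPred_exists_lt (R := fun c n => Sat (n + 1) c)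
      (h.primrecRel.comp (Primrec.succ.comp Primrec.snd) Primrec.fst) Primrec.succ
  refine hsearch.computablePred.of_eq fun c => ⟨fun hc => ?_, ?_⟩
  · obtain ⟨n, -, hn⟩ := id hc
    obtain ⟨φ, hφ, rfl⟩ := h.exists_formulaCode hn
    exact ⟨φ, hφ, (h.tSat_iff_exists_lt hφ).2 hc, rfl⟩
  · rintro ⟨φ, hφ, hsat, rfl⟩
    exact (h.tSat_iff_exists_lt hφ).1 hsat

theorem mem_listCardinals_exceptions (hφ : BoundedFormula.IsQF φ) {κ : Cardinal.{0}} :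
    κ ∈ listCardinals (exceptions Sat (formulaCode φ)) ↔
      1 ≤ κ ∧ κ ≤ Cardinal.aleph0 ∧ ¬ (κ ∈ Spec T φ ↔ Cardinal.aleph0 ∈ Spec T φ) := by
  have h₀ := h.aleph0_mem_Spec hφ (Nat.lt_succ_self _)
  constructor
  · rintro ⟨n, hn, rfl⟩
    obtain ⟨hpos, -, hne⟩ := mem_exceptions.1 hn
    refine ⟨by exact_mod_cast hpos, Cardinal.natCast_le_aleph0, ?_⟩
    rwa [h.natCast_mem_Spec hφ hpos, h₀]
  · rintro ⟨hpos, hle, hne⟩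
    rcases hle.lt_or_eq with hlt | rfl
    · obtain ⟨n, rfl⟩ := Cardinal.lt_aleph0.1 hlt
      have hn : 0 < n := by exact_mod_cast hpos
      have hnc : n ≤ formulaCode φ := not_lt.1 fun hlt =>
        hne (h.natCast_mem_Spec_iff_aleph0_mem_Spec hφ hlt)
      exact ⟨n, mem_exceptions.2 ⟨hn, hnc, by rwa [← h.natCast_mem_Spec hφ hn, ← h₀]⟩, rfl⟩
    · exact (hne Iff.rfl).elim

theorem gentle : Gentle T := by
  classical
  have hsat : PrimrecPred fun c => ¬ Sat (c + 1) c :=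
    (h.primrecRel.comp Primrec.succ Primrec.id).not
  refine ⟨fun c => (decide (¬ Sat (c + 1) c), exceptions Sat c),
    (hsat.decide.pair (primrec_exceptions h.primrecRel)).to_comp,
    fun φ hφ => ⟨fun n hn => ?_, ?_, ?_⟩⟩
  · exact (mem_exceptions.1 hn).1
  all_goals
    intro hb
    simp only [decide_eq_true_eq, decide_eq_false_iff_not, not_not,
      ← h.aleph0_mem_Spec hφ.isQF (Nat.lt_succ_self _)] at hb
    ext κ
    have hone : κ ∈ Spec T φ → 1 ≤ κ := one_le_of_mem_Spec
    have hle : κ ∈ Spec T φ → κ ≤ Cardinal.aleph0 := And.left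
    simp only [Set.mem_sdiff, Set.mem_ofPred_eq, h.mem_listCardinals_exceptions hφ.isQF]
    tauto

end DecidesSpectra

end Spectra

/-! ### The theory `T₌` -/

section Cardinality

variable {L : FirstOrder.Language.{0, 0}} {M : Type} [L.Structure M] [Nonempty M]

theorem realize_psiLe (n : ℕ) : M ⊨ psiLe L n ↔ Cardinal.mk M ≤ n := by
  rw [psiLe, Sentence.Realize, BoundedFormula.realize_exs]
  simp only [BoundedFormula.realize_all, BoundedFormula.realize_iSup,
    BoundedFormula.realize_bdEqual, Term.realize_var, Sum.elim_inr, Function.comp_apply,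
    Fin.snoc_last, Fin.snoc_castSucc]
  constructor
  · rintro ⟨xs, h⟩
    have hs : Function.Surjective xs := fun a => (h a).imp fun i hi => hi.symm
    simpa using Cardinal.mk_le_of_surjective hs
  · intro h
    rw [← Cardinal.mk_fin] at h
    obtain ⟨e⟩ := Cardinal.le_def _ _ |>.1 h
    exact ⟨Function.invFun e, fun a => ⟨e a, (Function.leftInverse_invFun e.injective a).symm⟩⟩

theorem realize_psiEq (n : ℕ) : M ⊨ psiEq L n ↔ Cardinal.mk M = n := by
  have hinf : M ⊨ psiEq L n ↔ M ⊨ Sentence.cardGe L n ∧ M ⊨ psiLe L n := BoundedFormula.realize_inf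
  rw [hinf, Sentence.realize_cardGe, realize_psiLe, le_antisymm_iff, and_comm]

end Cardinality

/-- The structure on `M` in which `Pₚ` is the only true predicate (none is, if `p = 0`). -/
@[reducible]
def predStructure (M : Type) (p : ℕ) : sigP.Structure M where
  funMap f := f.elim
  RelMap := fun {_} R _ => match R with
    | .P k => (k : ℕ) = p

theorem model_Teq_iff {M : Type} [sigP.Structure M] [Nonempty M] :
    M ⊨ Teq ↔ ∀ n : ℕ+, Structure.RelMap (symP n) (default : Fin 0 → M) →
      Cardinal.mk M = (n : ℕ) := by
  simp only [Teq, Theory.model_iff, Set.forall_mem_range, Sentence.Realize, Formula.realize_imp]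
  refine forall_congr' fun n => imp_congr ?_ (realize_psiEq _)
  rw [predAtom]
  refine Formula.realize_rel.trans ?_
  rw [Subsingleton.elim (fun i => Term.realize _ _) default]

theorem model_predStructure {M : Type} [Nonempty M] {p : ℕ} (h : p = 0 ∨ Cardinal.mk M = p) :
    let := predStructure M p
    M ⊨ Teq := by
  let := predStructure M p
  refine model_Teq_iff.2 fun n (hn : (n : ℕ) = p) => ?_
  rcases h with rfl | h
  · exact (n.ne_zero hn).elim
  · rw [h, hn]

theorem exists_forall_relMap_symP_iff {M : Type} [sigP.Structure M] [Nonempty M] (hM : M ⊨ Teq)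
    {n : ℕ} (hn : Cardinal.mk M = n) : ∃ p, (p = 0 ∨ p = n) ∧
      ∀ k : ℕ+, Structure.RelMap (symP k) (default : Fin 0 → M) ↔ (k : ℕ) = p := by
  have eq_of_relMap (k : ℕ+) (hk : Structure.RelMap (symP k) (default : Fin 0 → M)) : (k : ℕ) = n :=
    Nat.cast_injective ((model_Teq_iff.1 hM k hk).symm.trans hn)
  by_cases hP : ∃ k : ℕ+, Structure.RelMap (symP k) (default : Fin 0 → M)
  · obtain ⟨k, hk⟩ := hP
    refine ⟨n, Or.inr rfl, fun k' => ⟨eq_of_relMap k', fun h => ?_⟩⟩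
    rwa [PNat.eq (h.trans (eq_of_relMap k hk).symm)]
  · exact ⟨0, Or.inl rfl, fun k => iff_of_false (fun hk => hP ⟨k, hk⟩) k.ne_zero⟩

theorem not_relMap_symP_of_infinite {M : Type} [sigP.Structure M] [Infinite M] (hM : M ⊨ Teq)
    (k : ℕ+) : ¬ Structure.RelMap (symP k) (default : Fin 0 → M) := fun hk =>
  (Cardinal.aleph0_le_mk M).not_gt ((model_Teq_iff.1 hM k hk).trans_lt Cardinal.natCast_lt_aleph0)

/-- Evaluation of codes of `sigP`-terms under the parameters `(n, p, x)`, which stand for the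
structure with domain `{0, …, n - 1}` in which exactly `Pₚ` holds and for the valuation given by the
base-`n` digits of `x`. -/
def predTermEval (a : ℕ × ℕ × ℕ) (c : ℕ) : Option ℕ := (varDecode c).map (digit a.1 a.2.2)

/-- Evaluation of the codes of the atoms `Pₖ` under the parameters of `predTermEval`. -/
def predRelEval (a : ℕ × ℕ × ℕ) (c : ℕ) : Option Bool :=
  if c.unpair.1 = 0 ∧ c.unpair.2.unpair.2 = 0 ∧ 0 < c.unpair.2.unpair.1 then
    some (decide (c.unpair.2.unpair.1 = a.2.1))
  else none

theorem primrec_predTermEval : Primrec₂ predTermEval :=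
  Primrec.option_map (primrec_varDecode.comp Primrec.snd)
    (primrec_digit.comp (Primrec.pair (Primrec.fst.comp (Primrec.fst.comp Primrec.fst))
      (Primrec.pair (Primrec.snd.comp (Primrec.snd.comp (Primrec.fst.comp Primrec.fst)))
        Primrec.snd)))

theorem primrec_predRelEval : Primrec₂ predRelEval := by
  have hc : Primrec fun p : (ℕ × ℕ × ℕ) × ℕ => p.2.unpair := Primrec.unpair.comp Primrec.snd
  have hc2 : Primrec fun p : (ℕ × ℕ × ℕ) × ℕ => p.2.unpair.2.unpair :=
    Primrec.unpair.comp (Primrec.snd.comp hc)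
  refine Primrec.ite (PrimrecPred.and (Primrec.eq.comp (Primrec.fst.comp hc) (Primrec.const 0))
    (PrimrecPred.and (Primrec.eq.comp (Primrec.snd.comp hc2) (Primrec.const 0))
      (Primrec.nat_lt.comp (Primrec.const 0) (Primrec.fst.comp hc2)))) ?_ (Primrec.const _)
  exact Primrec.option_some.comp (Primrec.eq.decide.comp (Primrec.fst.comp hc2)
    (Primrec.fst.comp (Primrec.snd.comp Primrec.fst)))

theorem predRelEval_relCode (a : ℕ × ℕ × ℕ) (k : ℕ+) (ts : Fin 0 → sigP.Term (ℕ ⊕ Fin 0)) :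
    predRelEval a (relCode (symP k) ts) = some (decide ((k : ℕ) = a.2.1)) := by
  have h : (Encodable.encode (symP k) : ℕ) = k := rfl
  simp [predRelEval, relCode, h]

theorem le_relCode_symP (k : ℕ+) (ts : Fin 0 → sigP.Term (ℕ ⊕ Fin 0)) :
    (k : ℕ) ≤ relCode (symP k) ts :=
  (Nat.left_le_pair (k : ℕ) _).trans (Nat.right_le_pair 0 _)

theorem exists_relCode_of_predRelEval {a : ℕ × ℕ × ℕ} {c : ℕ} {b : Bool}
    (h : predRelEval a c = some b) : ∃ (k : ℕ+) (ts : Fin 0 → sigP.Term (ℕ ⊕ Fin 0)),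
      relCode (symP k) ts = c := by
  simp only [predRelEval, Option.ite_none_right_eq_some] at h
  obtain ⟨⟨h₁, h₂, hpos⟩, -⟩ := h
  have hpair : Nat.pair c.unpair.2.unpair.1 0 = c.unpair.2 := by rw [← h₂, Nat.pair_unpair]
  refine ⟨⟨_, hpos⟩, default, ?_⟩
  calc relCode (symP ⟨_, hpos⟩) default
      = Nat.pair 0 (Nat.pair c.unpair.2.unpair.1 0) := rfl
    _ = c := by rw [hpair, ← h₁, Nat.pair_unpair]

theorem exists_formulaCode_of_predEval {a : ℕ × ℕ × ℕ} {c : ℕ} {b : Bool}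
    (h : qfEval predTermEval predRelEval a c = some b) :
    ∃ φ : sigP.Formula ℕ, BoundedFormula.IsQF φ ∧ formulaCode φ = c := by
  refine exists_formulaCode_of_qfEval (fun c x hx => ?_) (fun c b hb => ?_) h
  · obtain ⟨i, hi, -⟩ := Option.map_eq_some_iff.1 hx
    exact ⟨_, termCode_of_varDecode hi⟩
  · obtain ⟨k, ts, rfl⟩ := exists_relCode_of_predRelEval hb
    exact ⟨0, symP k, ts, rfl⟩

theorem predEval_formulaCode {M : Type} [sigP.Structure M] {w : ℕ → M} {n p x : ℕ}
    {φ : sigP.Formula ℕ} {e : M → ℕ} (hφ : BoundedFormula.IsQF φ)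
    (he : Set.InjOn e (termValues (L := sigP) w (formulaCode φ)))
    (hx : ∀ i < formulaCode φ, digit n x i = e (w i))
    (hp : ∀ k : ℕ+, (k : ℕ) < formulaCode φ →
      (Structure.RelMap (symP k) (default : Fin 0 → M) ↔ (k : ℕ) = p)) :
    qfEval predTermEval predRelEval (n, p, x) (formulaCode φ) = some true ↔ φ.Realize w := by
  classical
  rw [qfEval_formulaCode he ?_ ?_ hφ le_rfl, Option.some_inj, decide_eq_true_iff]
  · rintro ((i | i) | f) hi
    · have hi' := hx i ((le_termCode_var i).trans_lt hi)
      simp only [predTermEval, varDecode_termCode, Option.map_some, hi', Term.realize_var,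
        Sum.elim_inl]
    · exact i.elim0
    · exact f.elim
  · rintro _ ⟨k⟩ ts hc
    refine (predRelEval_relCode _ k ts).trans ?_
    rw [Subsingleton.elim (fun i => (ts i).realize (Sum.elim w default)) default]
    exact congrArg some (decide_eq_decide.2 (hp k ((le_relCode_symP k ts).trans_lt hc)).symm)

/-- The formula with code `c` is true in a model of `T₌` with domain `{0, …, n - 1}`. The valuation
is found among the numbers with `c` digits in base `n`. -/
def PredSat (n c : ℕ) : Prop :=
  ∃ x < n ^ c,
    qfEval predTermEval predRelEval (n, 0, x) c = some true ∨
    qfEval predTermEval predRelEval (n, n, x) c = some true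

theorem primrecRel_predSat : PrimrecRel PredSat := by
  have h {f : ℕ × ℕ → ℕ} (hf : Primrec f) : PrimrecRel fun (a : ℕ × ℕ) (x : ℕ) =>
      qfEval predTermEval predRelEval (a.1, f a, x) a.2 = some true :=
    Primrec.eq.comp ((primrec_qfEval primrec_predTermEval primrec_predRelEval).comp
      (Primrec.pair (Primrec.fst.comp Primrec.fst)
        (Primrec.pair (hf.comp Primrec.fst) Primrec.snd))
      (Primrec.snd.comp Primrec.fst)) (Primrec.const _)
  exact primrecPred_exists_lt (R := fun (a : ℕ × ℕ) x =>
      qfEval predTermEval predRelEval (a.1, 0, x) a.2 = some true ∨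
      qfEval predTermEval predRelEval (a.1, a.1, x) a.2 = some true)
    (PrimrecPred.or (h (Primrec.const 0)) (h Primrec.fst))
    (primrec₂_pow.comp Primrec.fst Primrec.snd)

theorem predSat_iff {n c : ℕ} :
    PredSat n c ↔ ∃ p, (p = 0 ∨ p = n) ∧
      ∃ x < n ^ c, qfEval predTermEval predRelEval (n, p, x) c = some true := by
  simp only [PredSat]
  aesop

theorem predSat_of_injOn {M : Type} [sigP.Structure M] {w : ℕ → M} {n p : ℕ} {φ : sigP.Formula ℕ}
    {e : M → Fin n} (hφ : BoundedFormula.IsQF φ)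
    (he : Set.InjOn e (termValues (L := sigP) w (formulaCode φ))) (hpn : p = 0 ∨ p = n)
    (hp : ∀ k : ℕ+, Structure.RelMap (symP k) (default : Fin 0 → M) ↔ (k : ℕ) = p)
    (h : φ.Realize w) : PredSat n (formulaCode φ) := by
  obtain ⟨x, hx, hdigit⟩ := exists_digit_eq fun i : Fin (formulaCode φ) => e (w i)
  exact predSat_iff.2 ⟨p, hpn, x, hx, (predEval_formulaCode (e := fun a => e a) hφ
    (Fin.val_injective.comp_injOn he) (fun i hi => hdigit ⟨i, hi⟩) fun k _ => hp k).2 h⟩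

theorem natCast_mem_Spec_Teq {φ : sigP.Formula ℕ} {n : ℕ} (hφ : BoundedFormula.IsQF φ)
    (hn : 0 < n) : (n : Cardinal.{0}) ∈ Spec Teq φ ↔ PredSat n (formulaCode φ) := by
  constructor
  · rintro ⟨-, M, w, hw, hM⟩
    obtain ⟨e⟩ := Cardinal.eq.1 (hM.trans (Cardinal.mk_fin n).symm)
    obtain ⟨p, hpn, hp⟩ := exists_forall_relMap_symP_iff M.is_model hM
    exact predSat_of_injOn hφ e.injective.injOn hpn hp hw
  · rw [predSat_iff]
    rintro ⟨p, hpn, x, -, h⟩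
    let := predStructure (Fin n) p
    have : NeZero n := ⟨hn.ne'⟩
    have : Fin n ⊨ Teq := model_predStructure (hpn.imp_right fun h => by rw [h, Cardinal.mk_fin])
    refine ⟨Cardinal.natCast_le_aleph0, Theory.ModelType.of Teq (Fin n),
      fun i => ⟨digit n x i, digit_lt hn x i⟩, ?_, Cardinal.mk_fin n⟩
    exact (predEval_formulaCode hφ Fin.val_injective.injOn (fun _ _ => rfl) fun _ _ => Iff.rfl).1 h

theorem aleph0_mem_Spec_Teq {φ : sigP.Formula ℕ} {n : ℕ} (hφ : BoundedFormula.IsQF φ)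
    (hn : formulaCode φ < n) :
    Cardinal.aleph0.{0} ∈ Spec Teq φ ↔ PredSat n (formulaCode φ) := by
  constructor
  · rintro ⟨-, M, w, hw, hM⟩
    have : Infinite M := Cardinal.infinite_iff.2 hM.ge
    have : NeZero n := ⟨by omega⟩
    obtain ⟨e, he⟩ := exists_injOn_termValues (L := sigP) w hn.le
    exact predSat_of_injOn hφ he (Or.inl rfl) (fun k =>
      iff_of_false (not_relMap_symP_of_infinite M.is_model k) k.ne_zero) hw
  · rw [predSat_iff]
    rintro ⟨p, hpn, x, -, h⟩
    let := predStructure ℕ 0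
    have : ℕ ⊨ Teq := model_predStructure (Or.inl rfl)
    refine ⟨le_rfl, Theory.ModelType.of Teq ℕ, digit n x, ?_, Cardinal.mk_nat⟩
    refine (predEval_formulaCode hφ Function.injective_id.injOn (fun _ _ => rfl) fun k hk => ?_).1 h
    refine iff_of_false k.ne_zero ?_
    have := k.pos
    omega

theorem decidesSpectra_Teq : DecidesSpectra Teq PredSat where
  primrecRel := primrecRel_predSat
  exists_formulaCode h := by
    obtain ⟨x, -, h | h⟩ := h <;> exact exists_formulaCode_of_predEval h
  natCast_mem_Spec := natCast_mem_Spec_Teq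
  aleph0_mem_Spec := aleph0_mem_Spec_Teq

/-! ### The theory `T_f` -/

theorem encard_range_of_injective {α : Type*} {n : ℕ} {g : Fin n → α}
    (hg : Function.Injective g) : (Set.range g).encard = n := by
  rw [← Set.image_univ, hg.encard_image, Set.encard_univ, ENat.card_eq_coe_fintype_card,
    Fintype.card_fin]

theorem exists_injective_range_eq_of_encard_eq {α : Type*} {n : ℕ} {s : Set α}
    (hs : s.encard = n) : ∃ g : Fin n → α, Function.Injective g ∧ Set.range g = s := by
  have : Finite s := Set.finite_of_encard_eq_coe hs
  have hcard : Nat.card s = n := by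
    rw [Nat.card_coe_set_eq, Set.ncard, hs, ENat.toNat_natCast]
  let e := (Finite.equivFinOfCardEq hcard).symm
  exact ⟨Subtype.val ∘ e, Subtype.val_injective.comp e.injective,
    (e.surjective.range_comp _).trans Subtype.range_coe⟩

/-- The structure on `M` in which `s` is interpreted by `g`. -/
@[reducible]
def funStructure {M : Type} (g : M → M) : sigS.Structure M where
  funMap := fun {_} F => match F with
    | .s => fun xs => g (xs 0)
  RelMap R := R.elim

/-- The interpretation of `s` in `M`. -/
def interpS (M : Type) [sigS.Structure M] (x : M) : M := Structure.funMap symS fun _ => x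

/-- The fixed points of `s` in `M`. -/
def fixedSet (M : Type) [sigS.Structure M] : Set M := {x | interpS M x = x}

section Realize

variable {M : Type} [sigS.Structure M]

theorem realize_apply₁ {α : Type} (t : sigS.Term α) (v : α → M) :
    (symS.apply₁ t).realize v = interpS M (t.realize v) := by
  rw [Functions.apply₁, Term.realize_func, interpS]
  congr 1
  funext i
  rw [Subsingleton.elim i 0]
  rfl

theorem realize_distinctF {n : ℕ} {v : Empty → M} {xs : Fin n → M} :
    (distinctF n).Realize v xs ↔ Function.Injective xs := by
  simp only [distinctF, BoundedFormula.realize_iInf, BoundedFormula.realize_not,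
    BoundedFormula.realize_bdEqual, Term.realize_var, Sum.elim_inr, Function.comp_apply,
    Subtype.forall, Prod.forall]
  exact ⟨fun h => .of_lt_imp_ne h, fun h i j hij hx => hij.ne (h hx)⟩

variable {q : ∀ {m : ℕ}, sigS.Term (Empty ⊕ Fin m) → sigS.BoundedFormula Empty m} {Q : Set M}

theorem realize_atLeastF
    (hq : ∀ {m : ℕ} (t : sigS.Term (Empty ⊕ Fin m)) (v : Empty → M) (xs : Fin m → M),
      (q t).Realize v xs ↔ t.realize (Sum.elim v xs) ∈ Q) (n : ℕ) :
    M ⊨ atLeastF q n ↔ (n : ℕ∞) ≤ Q.encard := by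
  rw [atLeastF, Sentence.Realize, BoundedFormula.realize_exs]
  simp only [BoundedFormula.realize_inf, realize_distinctF, BoundedFormula.realize_iInf, hq,
    Term.realize_var, Sum.elim_inr, Function.comp_apply]
  constructor
  · rintro ⟨xs, hinj, hxs⟩
    rw [← encard_range_of_injective hinj]
    exact Set.encard_le_encard (Set.range_subset_iff.2 hxs)
  · intro h
    obtain ⟨s, hsQ, hs⟩ := Set.exists_subset_encard_eq h
    obtain ⟨xs, hinj, rfl⟩ := exists_injective_range_eq_of_encard_eq hs
    exact ⟨xs, hinj, Set.range_subset_iff.1 hsQ⟩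

theorem realize_exactlyF
    (hq : ∀ {m : ℕ} (t : sigS.Term (Empty ⊕ Fin m)) (v : Empty → M) (xs : Fin m → M),
      (q t).Realize v xs ↔ t.realize (Sum.elim v xs) ∈ Q) (n : ℕ) :
    M ⊨ exactlyF q n ↔ Q.encard = n := by
  rw [exactlyF, Sentence.Realize, BoundedFormula.realize_exs]
  simp only [BoundedFormula.realize_inf, realize_distinctF, BoundedFormula.realize_iInf, hq,
    Term.realize_var, Sum.elim_inr, Function.comp_apply, BoundedFormula.realize_all,
    BoundedFormula.realize_imp, BoundedFormula.realize_iSup, BoundedFormula.realize_bdEqual,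
    Fin.snoc_last, Fin.snoc_castSucc]
  constructor
  · rintro ⟨xs, ⟨hinj, hxs⟩, hQ⟩
    rw [← encard_range_of_injective hinj]
    exact congrArg Set.encard (Set.Subset.antisymm (fun a ha => (hQ a ha).imp fun _ => Eq.symm)
      (Set.range_subset_iff.2 hxs))
  · intro h
    obtain ⟨xs, hinj, rfl⟩ := exists_injective_range_eq_of_encard_eq h
    exact ⟨xs, ⟨hinj, Set.mem_range_self⟩, fun a ha => ha.imp fun _ => Eq.symm⟩

theorem realize_fixF {m : ℕ} (t : sigS.Term (Empty ⊕ Fin m)) (v : Empty → M) (xs : Fin m → M) :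
    (fixF t).Realize v xs ↔ t.realize (Sum.elim v xs) ∈ fixedSet M := by
  rw [fixF, BoundedFormula.realize_bdEqual, realize_apply₁]
  rfl

theorem realize_nonfixF {m : ℕ} (t : sigS.Term (Empty ⊕ Fin m)) (v : Empty → M)
    (xs : Fin m → M) :
    (nonfixF t).Realize v xs ↔ t.realize (Sum.elim v xs) ∈ (fixedSet M)ᶜ := by
  rw [nonfixF, BoundedFormula.realize_not, realize_fixF, Set.mem_compl_iff]

theorem model_Tf_iff (f : ℕ+ → Fin 2) :
    M ⊨ Tf f ↔ ∀ k : ℕ+,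
      ((countVal f 1 k : ℕ∞) ≤ (fixedSet M).encard ∧
        (countVal f 0 k : ℕ∞) ≤ (fixedSet M)ᶜ.encard) ∨
      ∃ i ≤ k, (fixedSet M).encard = countVal f 1 i ∧ (fixedSet M)ᶜ.encard = countVal f 0 i := by
  have realize_inf (φ ψ : sigS.Sentence) : M ⊨ φ ⊓ ψ ↔ M ⊨ φ ∧ M ⊨ ψ := Formula.realize_inf
  have realize_sup (φ ψ : sigS.Sentence) : M ⊨ φ ⊔ ψ ↔ M ⊨ φ ∨ M ⊨ ψ := Formula.realize_sup
  have realize_iSup (k : ℕ+) (φ : Finset.Icc (1 : ℕ+) k → sigS.Sentence) :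
      M ⊨ Formula.iSup φ ↔ ∃ i, M ⊨ φ i := Formula.realize_iSup
  simp only [Tf, Theory.model_iff, Set.forall_mem_range]
  refine forall_congr' fun k => ?_
  rw [realize_sup, realize_inf, realize_iSup]
  simp only [realize_inf, realize_atLeastF realize_fixF, realize_atLeastF realize_nonfixF,
    realize_exactlyF realize_fixF, realize_exactlyF realize_nonfixF, Subtype.exists,
    Finset.mem_Icc, one_le, true_and, exists_prop]

end Realize

theorem term_induction {α : Type} {motive : sigS.Term α → Prop}
    (var : ∀ i, motive (Term.var i))
    (apply : ∀ t, motive t → motive (symS.apply₁ t)) (t : sigS.Term α) : motive t := by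
  induction t with
  | var i => exact var i
  | @func l F ts ih =>
    cases F
    have : Term.func symS ts = symS.apply₁ (ts 0) := by
      rw [Functions.apply₁]
      congr 1
      funext i
      rw [Subsingleton.elim i 0]
      rfl
    exact this ▸ apply _ (ih 0)

/-- The code of `s(t)`, if `c` is the code of `t`. -/
def appCode (c : ℕ) : ℕ := Nat.pair 1 (Nat.pair 1 (Nat.pair 0 (Nat.pair c 0 + 1)))

/-- The code of `t`, if `c` is the code of `s(t)`. -/
def argCode (c : ℕ) : ℕ := (c.unpair.2.unpair.2.unpair.2 - 1).unpair.1

theorem argCode_appCode (c : ℕ) : argCode (appCode c) = c := by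
  simp [argCode, appCode]

theorem lt_appCode (c : ℕ) : c < appCode c := by
  calc c < Nat.pair c 0 + 1 := Nat.lt_succ_of_le (Nat.left_le_pair c 0)
    _ ≤ Nat.pair 0 (Nat.pair c 0 + 1) := Nat.right_le_pair _ _
    _ ≤ Nat.pair 1 (Nat.pair 0 (Nat.pair c 0 + 1)) := Nat.right_le_pair _ _
    _ ≤ appCode c := Nat.right_le_pair _ _

theorem argCode_lt {c : ℕ} (h : c = appCode (argCode c)) : argCode c < c :=
  (lt_appCode _).trans_eq h.symm

theorem termCode_apply₁ {α : Type} [Encodable α] (t : sigS.Term α) :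
    termCode (symS.apply₁ t) = appCode (termCode t) := by
  have h : (Encodable.encode symS : ℕ) = 0 := rfl
  simp [Functions.apply₁, termCode, appCode, h, List.ofFn_succ]

theorem primrec_argCode : Primrec argCode :=
  Primrec.fst.comp (Primrec.unpair.comp (Primrec.pred.comp
    (Primrec.snd.comp (Primrec.unpair.comp (Primrec.snd.comp (Primrec.unpair.comp
      (Primrec.snd.comp Primrec.unpair)))))))

theorem primrec_appCode : Primrec appCode :=
  Primrec₂.natPair.comp (Primrec.const 1) (Primrec₂.natPair.comp (Primrec.const 1)
    (Primrec₂.natPair.comp (Primrec.const 0)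
      (Primrec.succ.comp (Primrec₂.natPair.comp Primrec.id (Primrec.const 0)))))

/-- Evaluation of codes of `sigS`-terms under the parameters `(b, x, y)`: the domain is
`{0, …, b - 1}`, and the base-`b` digits of `x` and `y` are the values of `s` and of the variables,
respectively. -/
def funTermEval (a : ℕ × ℕ × ℕ) (c : ℕ) : Option ℕ :=
  if _h : c = appCode (argCode c) then (funTermEval a (argCode c)).map (digit a.1 a.2.1)
  else (varDecode c).map (digit a.1 a.2.2)
termination_by c
decreasing_by exact argCode_lt _h

theorem funTermEval_appCode (a : ℕ × ℕ × ℕ) (c : ℕ) :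
    funTermEval a (appCode c) = (funTermEval a c).map (digit a.1 a.2.1) := by
  rw [funTermEval, dif_pos (by rw [argCode_appCode]), argCode_appCode]

theorem funTermEval_var (a : ℕ × ℕ × ℕ) (i : ℕ) :
    funTermEval a (termCode (Term.var (Sum.inl i) : sigS.Term (ℕ ⊕ Fin 0))) =
      some (digit a.1 a.2.2 i) := by
  rw [funTermEval, dif_neg, varDecode_termCode, Option.map_some]
  intro h
  have := congrArg (fun c => c.unpair.1) h
  simp [appCode, termCode] at this

theorem primrec_funTermEval : Primrec₂ funTermEval := by
  let g : ℕ × ℕ × ℕ → List (Option ℕ) → Option (Option ℕ) := fun a l =>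
    some (if l.length = appCode (argCode l.length) then
      (l.getD (argCode l.length) none).map (digit a.1 a.2.1)
    else (varDecode l.length).map (digit a.1 a.2.2))
  refine Primrec.nat_strong_rec (g := g) funTermEval ?_ ?_
  · have hlength : Primrec fun p : (ℕ × ℕ × ℕ) × List (Option ℕ) => p.2.length :=
      Primrec.list_length.comp Primrec.snd
    have harg := primrec_argCode.comp hlength
    have hdigit {z : ℕ × ℕ × ℕ → ℕ} (hz : Primrec z) :
        Primrec₂ fun (p : (ℕ × ℕ × ℕ) × List (Option ℕ)) i => digit p.1.1 (z p.1) i :=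
      primrec_digit.comp (Primrec.pair (Primrec.fst.comp (Primrec.fst.comp Primrec.fst))
        (Primrec.pair (hz.comp (Primrec.fst.comp Primrec.fst)) Primrec.snd))
    exact Primrec.option_some.comp (Primrec.ite
      (Primrec.eq.comp hlength (primrec_appCode.comp harg))
      (Primrec.option_map ((Primrec.list_getD (α := Option ℕ) none).comp Primrec.snd harg)
        (hdigit (z := fun a => a.2.1) (Primrec.fst.comp Primrec.snd)))
      (Primrec.option_map (primrec_varDecode.comp hlength)
        (hdigit (z := fun a => a.2.2) (Primrec.snd.comp Primrec.snd))))
  · intro a n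
    rw [funTermEval]
    by_cases h : n = appCode (argCode n)
    · simp [g, ← h, List.getD, argCode_lt h]
    · simp [g, h]

theorem exists_termCode_of_funTermEval {a : ℕ × ℕ × ℕ} {c x : ℕ} (h : funTermEval a c = some x) :
    ∃ t : sigS.Term (ℕ ⊕ Fin 0), termCode t = c := by
  induction c using Nat.strong_induction_on generalizing x with
  | _ c ih =>
    rw [funTermEval] at h
    split_ifs at h with hc
    · obtain ⟨y, hy, -⟩ := Option.map_eq_some_iff.1 h
      obtain ⟨t, ht⟩ := ih _ (argCode_lt hc) hy
      exact ⟨symS.apply₁ t, by rw [termCode_apply₁, ht, ← hc]⟩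
    · obtain ⟨i, hi, -⟩ := Option.map_eq_some_iff.1 h
      exact ⟨_, termCode_of_varDecode hi⟩

section Correctness

variable {M : Type} [sigS.Structure M] {w : ℕ → M} {b x y N : ℕ} {e : M → ℕ}

theorem funTermEval_termCode
    (hx : ∀ z ∈ termValues (L := sigS) w N, digit b x (e z) = e (interpS M z))
    (hy : ∀ i < N, digit b y i = e (w i)) {t : sigS.Term (ℕ ⊕ Fin 0)} (ht : termCode t < N) :
    funTermEval (b, x, y) (termCode t) = some (e (t.realize (Sum.elim w default))) := by
  induction t using term_induction with
  | var i =>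
    rcases i with i | i
    · rw [funTermEval_var, hy i ((le_termCode_var i).trans_lt ht)]
      rfl
    · exact i.elim0
  | apply t ih =>
    rw [termCode_apply₁] at ht ⊢
    have hlt := (lt_appCode _).trans ht
    rw [funTermEval_appCode, ih hlt, Option.map_some, hx _ (Set.mem_image_of_mem _ hlt),
      realize_apply₁]

/-- The signature of `T_f` has no relation symbols, so its atomic formulas are equations. -/
def noRelEval (_ : ℕ × ℕ × ℕ) (_ : ℕ) : Option Bool := none

theorem funEval_formulaCode {φ : sigS.Formula ℕ} (hφ : BoundedFormula.IsQF φ)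
    (he : Set.InjOn e (termValues (L := sigS) w (formulaCode φ)))
    (hx : ∀ z ∈ termValues (L := sigS) w (formulaCode φ), digit b x (e z) = e (interpS M z))
    (hy : ∀ i < formulaCode φ, digit b y i = e (w i)) :
    qfEval funTermEval noRelEval (b, x, y) (formulaCode φ) = some true ↔ φ.Realize w := by
  classical
  rw [qfEval_formulaCode he (fun t ht => funTermEval_termCode hx hy ht) (fun R => R.elim) hφ le_rfl,
    Option.some_inj, decide_eq_true_iff]

end Correctness

theorem exists_formulaCode_of_funEval {a : ℕ × ℕ × ℕ} {c : ℕ} {b : Bool}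
    (h : qfEval funTermEval noRelEval a c = some b) :
    ∃ φ : sigS.Formula ℕ, BoundedFormula.IsQF φ ∧ formulaCode φ = c :=
  exists_formulaCode_of_qfEval (fun _ _ => exists_termCode_of_funTermEval)
    (fun _ _ h => (Option.some_ne_none _ h.symm).elim) h

/-- The formula with code `c` is true in some structure with domain `{0, …, c}`. -/
def FunSat (c : ℕ) : Prop :=
  ∃ x < (c + 1) ^ (c + 1), ∃ y < (c + 1) ^ (c + 1),
    qfEval funTermEval noRelEval (c + 1, x, y) c = some true

theorem primrecPred_funSat : PrimrecPred FunSat := by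
  have hb : Primrec fun c : ℕ => (c + 1) ^ (c + 1) := primrec₂_pow.comp Primrec.succ Primrec.succ
  have hc : Primrec fun q : (ℕ × ℕ) × ℕ => q.1.1 := Primrec.fst.comp Primrec.fst
  refine primrecPred_exists_lt (R := fun c x => ∃ y < (c + 1) ^ (c + 1),
    qfEval funTermEval noRelEval (c + 1, x, y) c = some true) ?_ hb
  refine primrecPred_exists_lt (R := fun (p : ℕ × ℕ) y =>
    qfEval funTermEval noRelEval (p.1 + 1, p.2, y) p.1 = some true) ?_ (hb.comp Primrec.fst)
  exact Primrec.eq.comp ((primrec_qfEval primrec_funTermEval (Primrec₂.const none)).comp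
    (Primrec.pair (Primrec.succ.comp hc)
      (Primrec.pair (Primrec.snd.comp Primrec.fst) Primrec.snd)) hc) (Primrec.const _)

theorem funSat_of_realize {M : Type} [sigS.Structure M] {w : ℕ → M} {φ : sigS.Formula ℕ}
    (hφ : BoundedFormula.IsQF φ) (h : φ.Realize w) : FunSat (formulaCode φ) := by
  have : Nonempty M := ⟨w 0⟩
  set N := formulaCode φ
  obtain ⟨e, he⟩ := exists_injOn_termValues (L := sigS) w (Nat.le_succ N)
  obtain ⟨x, hx, hdx⟩ := exists_digit_eq
    (e ∘ interpS M ∘ Function.invFunOn e (termValues (L := sigS) w N))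
  obtain ⟨y, hy, hdy⟩ := exists_digit_eq fun i : Fin (N + 1) => e (w i)
  refine ⟨x, hx, y, hy, (funEval_formulaCode (e := fun a => e a) hφ
    (Fin.val_injective.comp_injOn he) (fun z hz => ?_) fun i hi => hdy ⟨i, by omega⟩).2 h⟩
  rw [hdx, Function.comp_apply, Function.comp_apply, he.leftInvOn_invFunOn hz]

/-- A function on `ℕ` that agrees with the function coded by `x` on `{0, …, b - 1}` and has
infinitely many fixed points (even numbers) and infinitely many other points (odd numbers). -/
def extendDigits (b x n : ℕ) : ℕ :=
  if n < b then digit b x n else if n % 2 = 0 then n else n + 1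

theorem model_Tf_of_infinite {M : Type} [sigS.Structure M] (f : ℕ+ → Fin 2)
    (hfix : (fixedSet M).Infinite) (hnonfix : (fixedSet M)ᶜ.Infinite) : M ⊨ Tf f :=
  (model_Tf_iff f).2 fun _ => Or.inl (by
    rw [hfix.encard_eq, hnonfix.encard_eq]
    exact ⟨le_top, le_top⟩)

theorem model_Tf_extendDigits (f : ℕ+ → Fin 2) (b x : ℕ) :
    let := funStructure (extendDigits b x)
    ℕ ⊨ Tf f := by
  let := funStructure (extendDigits b x)
  have mem_fixedSet_iff (n : ℕ) (hn : b ≤ n) : n ∈ fixedSet ℕ ↔ n % 2 = 0 := by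
    change extendDigits b x n = n ↔ _
    rw [extendDigits, if_neg hn.not_gt]
    split_ifs with h <;> simp [h]
  refine model_Tf_of_infinite f
    (Set.infinite_of_forall_exists_gt fun n => ⟨2 * (n + b + 1), ?_, by omega⟩)
    (Set.infinite_of_forall_exists_gt fun n => ⟨2 * (n + b + 1) + 1, ?_, by omega⟩)
  · rw [mem_fixedSet_iff _ (by omega)]
    omega
  · rw [Set.mem_compl_iff, mem_fixedSet_iff _ (by omega)]
    omega

theorem tSat_Tf_of_funSat (f : ℕ+ → Fin 2) {φ : sigS.Formula ℕ} (hφ : BoundedFormula.IsQF φ)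
    (h : FunSat (formulaCode φ)) : TSat (Tf f) φ := by
  obtain ⟨x, -, y, -, h⟩ := h
  set b := formulaCode φ + 1
  let := funStructure (extendDigits b x)
  have : ℕ ⊨ Tf f := model_Tf_extendDigits f b x
  have termValues_lt : ∀ z ∈ termValues (L := sigS) (digit b y) (formulaCode φ), z < b := by
    rintro _ ⟨t, -, rfl⟩
    induction t using term_induction with
    | var i =>
      rcases i with i | i
      · exact digit_lt (Nat.succ_pos _) _ _
      · exact i.elim0
    | apply t ih =>
      refine (realize_apply₁ t _).trans_lt ((if_pos ih).trans_lt ?_)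
      exact digit_lt (Nat.succ_pos _) _ _
  exact ⟨Theory.ModelType.of (Tf f) ℕ, digit b y, (funEval_formulaCode (e := id) hφ
    Function.injective_id.injOn (fun z hz => (if_pos (termValues_lt z hz)).symm)
    fun _ _ => rfl).1 h⟩

theorem decidableTheory_Tf (f : ℕ+ → Fin 2) : DecidableTheory (Tf f) := by
  refine primrecPred_funSat.computablePred.of_eq fun c => ⟨fun h => ?_, ?_⟩
  · have ⟨_, _, _, _, heval⟩ := h
    obtain ⟨φ, hφ, rfl⟩ := exists_formulaCode_of_funEval heval
    exact ⟨φ, hφ, tSat_Tf_of_funSat f hφ h, rfl⟩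
  · rintro ⟨φ, hφ, ⟨M, w, hw⟩, rfl⟩
    exact funSat_of_realize hφ hw

/-! ### Finite models of `T_f` -/

section Counting

variable (f : ℕ+ → Fin 2) (i : Fin 2)

theorem countVal_eq_count (k : ℕ+) :
    countVal f i k = Nat.count (fun j : ℕ => f j.succPNat = i) k := by
  rw [countVal, Nat.count_eq_card_filter_range]
  refine Finset.card_bij' (fun j _ => j.natPred) (fun j _ => j.succPNat) ?_ ?_ ?_ ?_
  · intro j hj
    simp only [Finset.mem_filter, Finset.mem_Icc, ← PNat.coe_le_coe] at hj
    have := j.natPred_add_one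
    simp only [Finset.mem_filter, Finset.mem_range, PNat.succPNat_natPred]
    exact ⟨by omega, hj.2⟩
  · intro j hj
    simp only [Finset.mem_filter, Finset.mem_range] at hj
    simp only [Finset.mem_filter, Finset.mem_Icc, one_le, true_and, ← PNat.coe_le_coe,
      Nat.succPNat_coe]
    exact ⟨hj.1, hj.2⟩
  · exact fun j _ => PNat.succPNat_natPred j
  · exact fun j _ => Nat.natPred_succPNat j

theorem countVal_mono : Monotone (countVal f i) := fun _ _ h =>
  Finset.card_le_card (Finset.filter_subset_filter _ (Finset.Icc_subset_Icc_right h))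

theorem countVal_add_countVal (k : ℕ+) : countVal f 1 k + countVal f 0 k = k := by
  have ne_one_iff (x : Fin 2) : x = 0 ↔ ¬ x = 1 := by omega
  simp only [countVal, ne_one_iff, Finset.card_filter_add_card_filter_not, PNat.card_Icc]
  simp

end Counting

theorem model_Tf_iff_of_card {M : Type} [sigS.Structure M] [Finite M] (f : ℕ+ → Fin 2) {n : ℕ+}
    (hn : Nat.card M = n) : M ⊨ Tf f ↔ (fixedSet M).ncard = countVal f 1 n := by
  have hcompl := Set.ncard_add_ncard_compl (fixedSet M)
  have hcount := countVal_add_countVal f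
  simp only [model_Tf_iff, ← Set.Finite.cast_ncard_eq (Set.toFinite _), Nat.cast_le, Nat.cast_inj]
  constructor
  · intro h
    have hcount_n := hcount n
    rcases h n with h | ⟨i, -, h₁, h₀⟩
    · omega
    · have hi : i = n := PNat.eq (by rw [← hcount i]; omega)
      rw [h₁, hi]
  · intro h k
    have h₀ : (fixedSet M)ᶜ.ncard = countVal f 0 n := by
      have := hcount n
      omega
    rw [h, h₀]
    rcases le_total k n with hkn | hnk
    · exact Or.inl ⟨countVal_mono f 1 hkn, countVal_mono f 0 hkn⟩
    · exact Or.inr ⟨n, hnk, rfl, rfl⟩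

/-! ### Finite conjunctions -/

section Conjunctions

variable {L : FirstOrder.Language.{0, 0}}

/-- The conjunction `φ 0 ⊓ … ⊓ φ (m - 1)`, defined by recursion on `m` so that its code is
primitive recursive in the codes of the conjuncts. -/
def conjBelow (φ : ℕ → L.Formula ℕ) : ℕ → L.Formula ℕ
  | 0 => ⊤
  | m + 1 => conjBelow φ m ⊓ φ m

theorem isQF_conjBelow {φ : ℕ → L.Formula ℕ} (h : ∀ i, BoundedFormula.IsQF (φ i)) (m : ℕ) :
    BoundedFormula.IsQF (conjBelow φ m) := by
  induction m with
  | zero => exact BoundedFormula.IsQF.top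
  | succ m ih => exact ih.inf (h m)

theorem realize_conjBelow {M : Type} [L.Structure M] {φ : ℕ → L.Formula ℕ} {m : ℕ} {v : ℕ → M} :
    (conjBelow φ m).Realize v ↔ ∀ i < m, (φ i).Realize v := by
  induction m with
  | zero => simp [conjBelow, Formula.Realize]
  | succ m ih => rw [conjBelow, Formula.realize_inf, ih, Nat.forall_lt_succ_right]

variable [∀ n, Encodable (L.Functions n)] [∀ n, Encodable (L.Relations n)]
  {α : Type*} [Primcodable α]

theorem primrec_formulaCode_bdEqual {t₁ t₂ : α → L.Term (ℕ ⊕ Fin 0)}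
    (h₁ : Primrec fun a => termCode (t₁ a)) (h₂ : Primrec fun a => termCode (t₂ a)) :
    Primrec fun a => formulaCode ((t₁ a).bdEqual (t₂ a)) :=
  Primrec₂.natPair.comp (Primrec.const 1) (Primrec₂.natPair.comp h₁ h₂)

theorem primrec_formulaCode_not {φ : α → L.Formula ℕ} (hφ : Primrec fun a => formulaCode (φ a)) :
    Primrec fun a => formulaCode (φ a).not :=
  Primrec₂.natPair.comp (Primrec.const 3) (Primrec₂.natPair.comp hφ (Primrec.const _))

/-- The code of a conjunction as a function of the codes of the conjuncts. The conjunction `φ ⊓ ψ`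
abbreviates `(φ → (ψ → ⊥)) → ⊥`. -/
def infCode (a b : ℕ) : ℕ :=
  Nat.pair 3 (Nat.pair
    (Nat.pair 3 (Nat.pair a (Nat.pair 3 (Nat.pair b (Nat.pair 0 0))))) (Nat.pair 0 0))

theorem formulaCode_inf (φ ψ : L.Formula ℕ) :
    formulaCode (φ ⊓ ψ) = infCode (formulaCode φ) (formulaCode ψ) := rfl

theorem primrec₂_infCode : Primrec₂ infCode :=
  have himp : Primrec₂ fun a b : ℕ => Nat.pair 3 (Nat.pair a b) :=
    Primrec₂.natPair.comp (Primrec.const 3) Primrec₂.natPair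
  himp.comp (himp.comp Primrec.fst (himp.comp Primrec.snd (Primrec.const _))) (Primrec.const _)

theorem primrec_formulaCode_inf {φ ψ : α → L.Formula ℕ} (hφ : Primrec fun a => formulaCode (φ a))
    (hψ : Primrec fun a => formulaCode (ψ a)) : Primrec fun a => formulaCode (φ a ⊓ ψ a) :=
  (primrec₂_infCode.comp hφ hψ).of_eq fun a => (formulaCode_inf (φ a) (ψ a)).symm

theorem primrec_formulaCode_conjBelow {φ : α → ℕ → L.Formula ℕ} {m : α → ℕ}
    (hφ : Primrec fun p : α × ℕ => formulaCode (φ p.1 p.2)) (hm : Primrec m) :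
    Primrec fun a => formulaCode (conjBelow (φ a) (m a)) := by
  have hstep : Primrec₂ fun (a : α) (p : ℕ × ℕ) => infCode p.2 (formulaCode (φ a p.1)) :=
    primrec₂_infCode.comp (Primrec.snd.comp Primrec.snd)
      (hφ.comp (Primrec.pair Primrec.fst (Primrec.fst.comp Primrec.snd)))
  refine (Primrec.nat_rec' hm (Primrec.const (formulaCode (⊤ : L.Formula ℕ))) hstep).of_eq
    fun a => ?_
  induction m a with
  | zero => rfl
  | succ m ih => rw [conjBelow, formulaCode_inf, ← ih]

end Conjunctions

theorem DecidableTheory.computablePred_tSat {L : FirstOrder.Language.{0, 0}}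
    [∀ n, Encodable (L.Functions n)] [∀ n, Encodable (L.Relations n)] {T : L.Theory}
    (hT : DecidableTheory T) {α : Type*} [Primcodable α] {φ : α → L.Formula ℕ}
    (hφ : ∀ a, BoundedFormula.IsQF (φ a)) (hcode : Computable fun a => formulaCode (φ a)) :
    ComputablePred fun a => TSat T (φ a) := by
  refine ComputablePred.computable_of_manyOneReducible ⟨_, hcode, fun a => ?_⟩ hT
  refine ⟨fun h => ⟨φ a, hφ a, h, rfl⟩, ?_⟩
  rintro ⟨ψ, -, hψ, hψcode⟩
  rwa [← formulaCode_injective hψcode]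

/-! ### The combination `T₌ ⊕ T_f` -/

theorem model_combine_iff {L₁ L₂ : FirstOrder.Language.{0, 0}} (T₁ : L₁.Theory) (T₂ : L₂.Theory)
    (M : Type) [L₁.Structure M] [L₂.Structure M] [(L₁.sum L₂).Structure M]
    [(LHom.sumInl : L₁ →ᴸ L₁.sum L₂).IsExpansionOn M]
    [(LHom.sumInr : L₂ →ᴸ L₁.sum L₂).IsExpansionOn M] :
    M ⊨ combine T₁ T₂ ↔ M ⊨ T₁ ∧ M ⊨ T₂ := by
  rw [combine, Theory.model_union_iff, LHom.onTheory_model, LHom.onTheory_model]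

/-- The signature of `T₌ ⊕ T_f`. -/
abbrev sigPS : FirstOrder.Language.{0, 0} := sigP.sum sigS

/-- The predicate `Pₙ` as a formula of the combined signature. -/
def predFormula (n : ℕ+) : sigPS.Formula ℕ :=
  ((LHom.sumInl : sigP →ᴸ sigPS).onRelation (symP n)).formula default

/-- The variable `xᵢ` as a term of the combined signature. -/
def varTerm (i : ℕ) : sigPS.Term (ℕ ⊕ Fin 0) := Term.var (Sum.inl i)

/-- The formula `s(xᵢ) = xᵢ` of the combined signature. -/
def fixedVarFormula (i : ℕ) : sigPS.Formula ℕ :=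
  (((LHom.sumInr : sigS →ᴸ sigPS).onFunction symS).apply₁ (varTerm i)).bdEqual (varTerm i)

/-- `Pₙ`, and `x₀, …, xₘ₋₁` are pairwise distinct fixed points of `s`. -/
def fixedPointsQuery (n : ℕ+) (m : ℕ) : sigPS.Formula ℕ :=
  predFormula n ⊓ conjBelow (fun j => fixedVarFormula j ⊓
    conjBelow (fun i => ((varTerm i).bdEqual (varTerm j)).not) j) m

theorem isQF_fixedPointsQuery (n : ℕ+) (m : ℕ) : BoundedFormula.IsQF (fixedPointsQuery n m) :=
  (BoundedFormula.IsAtomic.rel _ _).isQF.inf (isQF_conjBelow (fun j =>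
    (BoundedFormula.IsAtomic.equal _ _).isQF.inf (isQF_conjBelow (fun _ =>
      (BoundedFormula.IsAtomic.equal _ _).isQF.not) j)) m)

theorem primrec_termCode_varTerm : Primrec fun i => termCode (varTerm i) :=
  Primrec₂.natPair.comp (Primrec.const 0) (Primrec.nat_double)

theorem primrec_formulaCode_predFormula :
    Primrec fun k : ℕ => formulaCode (predFormula k.succPNat) :=
  Primrec₂.natPair.comp (Primrec.const 2) (Primrec₂.natPair.comp (Primrec.const 0)
    (Primrec₂.natPair.comp (Primrec.nat_double.comp Primrec.succ) (Primrec.const 0)))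

theorem primrec_formulaCode_fixedVarFormula : Primrec fun i => formulaCode (fixedVarFormula i) := by
  refine primrec_formulaCode_bdEqual ?_ primrec_termCode_varTerm
  have hargs : Primrec fun i => Encodable.encode [termCode (varTerm i)] :=
    Primrec.encode.comp (Primrec.list_cons.comp primrec_termCode_varTerm (Primrec.const []))
  exact Primrec₂.natPair.comp (Primrec.const 1) (Primrec₂.natPair.comp (Primrec.const 1)
    (Primrec₂.natPair.comp (Primrec.const 1) hargs))

theorem primrec_formulaCode_fixedPointsQuery :
    Primrec fun p : ℕ × ℕ => formulaCode (fixedPointsQuery p.1.succPNat p.2) := by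
  have hdistinct : Primrec fun j =>
      formulaCode (conjBelow (fun i => ((varTerm i).bdEqual (varTerm j)).not) j) :=
    primrec_formulaCode_conjBelow (φ := fun j i => ((varTerm i).bdEqual (varTerm j)).not)
      (primrec_formulaCode_not (primrec_formulaCode_bdEqual
        (primrec_termCode_varTerm.comp Primrec.snd) (primrec_termCode_varTerm.comp Primrec.fst)))
      Primrec.id
  refine primrec_formulaCode_inf (primrec_formulaCode_predFormula.comp Primrec.fst)
    (primrec_formulaCode_conjBelow (φ := fun _ j => fixedVarFormula j ⊓
      conjBelow (fun i => ((varTerm i).bdEqual (varTerm j)).not) j) ?_ Primrec.snd)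
  exact primrec_formulaCode_inf (primrec_formulaCode_fixedVarFormula.comp Primrec.snd)
    (hdistinct.comp Primrec.snd)

theorem injOn_Iio_iff {M : Type*} {v : ℕ → M} {m : ℕ} :
    Set.InjOn v (Set.Iio m) ↔ ∀ j < m, ∀ i < j, v i ≠ v j := by
  refine ⟨fun h j hj i hij hv => hij.ne (h (hij.trans hj) hj hv), fun h i hi j hj hv => ?_⟩
  rcases lt_trichotomy i j with hij | hij | hij
  · exact absurd hv (h j hj i hij)
  · exact hij
  · exact absurd hv.symm (h i hi j hij)

section Realize

variable {M : Type} [sigPS.Structure M]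

theorem realize_predFormula [sigP.Structure M]
    [(LHom.sumInl : sigP →ᴸ sigPS).IsExpansionOn M] (n : ℕ+) (v : ℕ → M) :
    (predFormula n).Realize v ↔ Structure.RelMap (symP n) (default : Fin 0 → M) := by
  rw [predFormula, Formula.realize_rel, LHom.map_onRelation]
  exact iff_of_eq (congrArg _ (Subsingleton.elim _ _))

theorem realize_fixedVarFormula [sigS.Structure M]
    [(LHom.sumInr : sigS →ᴸ sigPS).IsExpansionOn M] (i : ℕ) (v : ℕ → M) :
    (fixedVarFormula i).Realize v ↔ v i ∈ fixedSet M := by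
  rw [fixedVarFormula, Formula.Realize, BoundedFormula.realize_bdEqual,
    Term.realize_functions_apply₁, LHom.map_onFunction, Matrix.vec_single_eq_const]
  rfl

theorem realize_fixedPointsQuery [sigP.Structure M] [sigS.Structure M]
    [(LHom.sumInl : sigP →ᴸ sigPS).IsExpansionOn M]
    [(LHom.sumInr : sigS →ᴸ sigPS).IsExpansionOn M] (n : ℕ+) (m : ℕ) (v : ℕ → M) :
    (fixedPointsQuery n m).Realize v ↔ Structure.RelMap (symP n) (default : Fin 0 → M) ∧
      (∀ i < m, v i ∈ fixedSet M) ∧ Set.InjOn v (Set.Iio m) := by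
  have realize_ne (i j : ℕ) :
      Formula.Realize ((varTerm i).bdEqual (varTerm j)).not v ↔ v i ≠ v j := Iff.rfl
  simp only [fixedPointsQuery, Formula.realize_inf, realize_conjBelow, realize_predFormula,
    realize_fixedVarFormula, realize_ne, forall_and, injOn_Iio_iff]

end Realize

theorem le_countVal_of_tSat {f : ℕ+ → Fin 2} {n : ℕ+} {m : ℕ}
    (h : TSat (combine Teq (Tf f)) (fixedPointsQuery n m)) : m ≤ countVal f 1 n := by
  obtain ⟨M, v, hv⟩ := h
  let := (LHom.sumInl : sigP →ᴸ sigPS).reduct M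
  let := (LHom.sumInr : sigS →ᴸ sigPS).reduct M
  obtain ⟨hTeq, hTf⟩ := (model_combine_iff _ _ M).1 M.is_model
  obtain ⟨hP, hfix, hinj⟩ := (realize_fixedPointsQuery n m v).1 hv
  have hcard : Nat.card M = n := by
    rw [Nat.card, model_Teq_iff.1 hTeq n hP, Cardinal.toNat_natCast]
  have : Finite M := Nat.finite_of_card_ne_zero (hcard ▸ n.ne_zero)
  calc m = (v '' Set.Iio m).ncard := by simp [hinj.ncard_image, Set.ncard_eq_toFinset_card']
    _ ≤ (fixedSet M).ncard := Set.ncard_le_ncard (Set.image_subset_iff.2 hfix)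
    _ = countVal f 1 n := (model_Tf_iff_of_card f hcard).1 hTf

theorem tSat_of_le_countVal {f : ℕ+ → Fin 2} {n : ℕ+} {m : ℕ} (hm : 0 < m)
    (h : m ≤ countVal f 1 n) : TSat (combine Teq (Tf f)) (fixedPointsQuery n m) := by
  set k := countVal f 1 n
  have hkn : k ≤ n := (Nat.le_add_right _ _).trans_eq (countVal_add_countVal f n)
  let := predStructure (Fin n) n
  let := funStructure fun x : Fin n => if (x : ℕ) < k then x else 0
  have hfixed : fixedSet (Fin n) = {x : Fin n | (x : ℕ) < k} := by
    ext x
    change (if (x : ℕ) < k then x else 0) = x ↔ (x : ℕ) < k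
    split_ifs with hx
    · exact iff_of_true rfl hx
    · refine iff_of_false (fun h0 => hx ?_) hx
      rw [← h0]
      exact hm.trans_le h
  have hTeq : Fin n ⊨ Teq := model_predStructure (Or.inr (Cardinal.mk_fin _))
  have hTf : Fin n ⊨ Tf f := by
    refine (model_Tf_iff_of_card f (Nat.card_fin _)).2 ?_
    rw [hfixed, Set.ncard_eq_toFinset_card', Set.toFinset_ofPred, Fin.card_filter_val_lt]
    exact min_eq_right hkn
  have : Fin n ⊨ combine Teq (Tf f) := (model_combine_iff _ _ _).2 ⟨hTeq, hTf⟩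
  have hval (i : ℕ) (hi : i < m) : (Fin.ofNat n i : ℕ) = i :=
    Nat.mod_eq_of_lt (hi.trans_le (h.trans hkn))
  refine ⟨Theory.ModelType.of _ (Fin n), Fin.ofNat n,
    (realize_fixedPointsQuery n m _).2 ⟨rfl, fun i hi => ?_, fun i hi j hj hij => ?_⟩⟩
  · exact hfixed.ge ((hval i hi).trans_lt (hi.trans_le h))
  · rw [← hval i hi, hij, hval j hj]

theorem not_decidableTheory_combine {f : ℕ+ → Fin 2}
    (hf : ¬ Computable fun n : ℕ => f n.succPNat) : ¬ DecidableTheory (combine Teq (Tf f)) := by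
  intro hdec
  have hcode : Computable fun p : ℕ × ℕ =>
      formulaCode (fixedPointsQuery p.1.succPNat (p.2 + 1)) :=
    (primrec_formulaCode_fixedPointsQuery.comp
      (Primrec.pair Primrec.fst (Primrec.succ.comp Primrec.snd))).to_comp
  have hlt : ComputablePred fun p : ℕ × ℕ => p.2 < countVal f 1 p.1.succPNat :=
    (hdec.computablePred_tSat (fun _ => isQF_fixedPointsQuery _ _) hcode).of_eq
      fun _ => ⟨le_countVal_of_tSat, tSat_of_le_countVal (Nat.succ_pos _)⟩
  have hcount : Computable (Nat.count fun j => f j.succPNat = 1) := by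
    have hsucc : Computable fun n : ℕ => countVal f 1 n.succPNat :=
      computable_of_computablePred_lt hlt
    refine (Computable.nat_casesOn Computable.id (Computable.const 0)
      (hsucc.comp Computable.snd).to₂).of_eq fun n => ?_
    cases n with
    | zero => rfl
    | succ n => exact countVal_eq_count f 1 n.succPNat
  exact hf (computable_of_computablePred_eq_one (computablePred_of_computable_count hcount))

/-! ### Admissible functions -/

theorem exists_not_computable : ∃ h : ℕ → Bool, ¬ Computable h := by
  classical
  refine ⟨fun n => decide (∃ c : Nat.Partrec.Code, Encodable.encode c = n ∧ (c.eval 0).Dom),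
    fun h => ComputablePred.halting_problem 0 ⟨Classical.decPred _, ?_⟩⟩
  refine (h.comp Computable.encode).of_eq fun c => decide_eq_decide.2 ?_
  constructor
  · rintro ⟨c', hc, hd⟩
    rwa [← Encodable.encode_injective hc]
  · exact fun hd => ⟨c, rfl, hd⟩

/-- The function on `{1, 2, 3, …}` that takes the values `b j` and `1 - b j` at `2j + 1` and
`2j + 2`. -/
def pairedValues (b : ℕ → Fin 2) (n : ℕ+) : Fin 2 :=
  if n.natPred % 2 = 0 then b (n.natPred / 2) else 1 - b (n.natPred / 2)

theorem pairedValues_succPNat_two_mul (b : ℕ → Fin 2) (j : ℕ) :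
    pairedValues b (2 * j).succPNat = b j := by
  simp [pairedValues]

theorem pairedValues_succPNat_two_mul_add_one (b : ℕ → Fin 2) (j : ℕ) :
    pairedValues b (2 * j + 1).succPNat = 1 - b j := by
  have : (2 * j + 1) / 2 = j := by omega
  simp [pairedValues, Nat.add_mod, this]

theorem countVal_pairedValues (b : ℕ → Fin 2) (i : Fin 2) {k : ℕ+} {j : ℕ} (hk : (k : ℕ) = 2 * j) :
    countVal (pairedValues b) i k = j := by
  rw [countVal_eq_count, hk]
  clear hk
  induction j with
  | zero => rfl
  | succ j ih =>
    have key (i x : Fin 2) : (if x = i then 1 else 0) + (if 1 - x = i then 1 else 0) = 1 := by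
      decide +revert
    rw [Nat.mul_succ, Nat.count_succ, Nat.count_succ, ih, pairedValues_succPNat_two_mul,
      pairedValues_succPNat_two_mul_add_one, add_assoc, key]

theorem exists_admissible : ∃ f : ℕ+ → Fin 2, Admissible f := by
  obtain ⟨h, hh⟩ := exists_not_computable
  let b (j : ℕ) : Fin 2 := Nat.casesOn j 1 fun j => bif h j then 1 else 0
  refine ⟨pairedValues b, fun hf => hh ?_, pairedValues_succPNat_two_mul b 0, fun k hk => ?_⟩
  · have hb : Computable b := (hf.comp Primrec.nat_double.to_comp).of_eq
      (pairedValues_succPNat_two_mul b)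
    refine (Primrec.eq.decide.to_comp.comp (hb.comp Computable.succ)
      (Computable.const (1 : Fin 2))).of_eq fun j => ?_
    cases hj : h j <;> simp [b, hj]
  · have hpow : ((2 ^ k : ℕ+) : ℕ) = 2 * 2 ^ (k - 1) := by
      rw [PNat.pow_coe, mul_pow_sub_one (Nat.one_le_iff_ne_zero.1 hk)]
      rfl
    rw [countVal_pairedValues b 0 hpow, countVal_pairedValues b 1 hpow]

end TheoryCombination

theorem mainTheorem5_general :
    (∃ f : ℕ+ → Fin 2, TheoryCombination.Admissible f) ∧
    TheoryCombination.DecidableTheory TheoryCombination.Teq ∧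
    TheoryCombination.Gentle TheoryCombination.Teq ∧
    ∀ f : ℕ+ → Fin 2, TheoryCombination.DecidableTheory (TheoryCombination.Tf f) ∧
      ((¬ Computable fun n : ℕ => f n.succPNat) →
        ¬ TheoryCombination.DecidableTheory
          (TheoryCombination.combine TheoryCombination.Teq (TheoryCombination.Tf f))) :=
  ⟨TheoryCombination.exists_admissible, TheoryCombination.decidesSpectra_Teq.decidableTheory,
    TheoryCombination.decidesSpectra_Teq.gentle, fun f =>
      ⟨TheoryCombination.decidableTheory_Tf f, TheoryCombination.not_decidableTheory_combine⟩⟩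

theorem mainTheorem5 :
    (∃ f : ℕ+ → Fin 2, TheoryCombination.Admissible f) ∧
    ∀ f : ℕ+ → Fin 2, TheoryCombination.Admissible f →
      TheoryCombination.DecidableTheory TheoryCombination.Teq ∧
      TheoryCombination.DecidableTheory (TheoryCombination.Tf f) ∧
      TheoryCombination.Gentle TheoryCombination.Teq ∧
      ¬ TheoryCombination.DecidableTheory
          (TheoryCombination.combine TheoryCombination.Teq (TheoryCombination.Tf f)) :=
  have ⟨hadm, hdec, hgentle, hTf⟩ := mainTheorem5_general
  ⟨hadm, fun f hf => ⟨hdec, (hTf f).1, hgentle, (hTf f).2 hf.not_computable⟩⟩
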